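/- All graphs are finite and simple. A graph is \emph{outerplanar} if it can be drawn in the plane without crossings so that all its vertices lie on the boundary of the outer (unbounded) face. The \emph{treedepth} $\mathrm{td}(G)$ of a graph $G$ is the minimum integer $d\ge 0$ for which there is a rooted forest with vertex set $V(G)$, of depth at most $d-1$ (roots have depth $0$), such that every edge of $G$ joins a vertex to one of its ancestors or descendants in the forest. \textbf{Theorem.} The class of outerplanar graphs is fractionally $\mathrm{td}$-fragile at rate $r(a)=2a(1+\lceil\log_2 a\rceil)$. That is, $r$ is non-negative and non-decreasing and, for every outerplanar graph $G$ and every positive integer $a$, there is a probability distribution on the subsets $X\subseteq V(G)$ with $\mathrm{td}(G-X)\le 2a(1+\lceil \log_2 a\rceil)$ such that each vertex of $G$ belongs to the random set $X$ with probability at most $1/a$. Moreover, if $G$ is an outerplanar graph that is chordal (every induced cycle of $G$ is a triangle), $v$ is a vertex of $G$, $j\ge 0$ is an integer, and $L_j$ is the set of vertices of $G$ at distance exactly $j$ from $v$, then every connected component of $G[L_j]$ is a path. -/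

import Mathlib

universe u

namespace SimpleGraph

/-! ### Plane drawings and outerplanar graphs -/

/-- A crossing-free drawing of a simple graph in the plane `ℂ = ℝ²`: vertices are distinct points,
an edge `uv` is drawn as a simple arc (the image of an injective continuous path) from the point
of `u` to the point of `v`, an arc contains no vertex points other than its ends, and two
different arcs meet only in the points of common end vertices. -/
structure PlaneDrawing {V : Type u} (G : SimpleGraph V) where
  point : V → ℂ
  arc : Sym2 V → Set ℂ
  point_injective : Function.Injective point
  isArc : ∀ u v : V, G.Adj u v →
    ∃ γ : _root_.Path (point u) (point v), Function.Injective γ ∧ Set.range γ = arc s(u, v)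
  point_mem_arc : ∀ e ∈ G.edgeSet, ∀ w : V, point w ∈ arc e → w ∈ e
  arc_inter_arc : ∀ e ∈ G.edgeSet, ∀ f ∈ G.edgeSet, e ≠ f →
    ∀ z ∈ arc e ∩ arc f, ∃ w : V, w ∈ e ∧ w ∈ f ∧ point w = z

namespace PlaneDrawing

variable {V : Type u} {G : SimpleGraph V}

/-- The set of all points of the plane used by the drawing. -/
def carrier (D : PlaneDrawing G) : Set ℂ :=
  Set.range D.point ∪ ⋃ e ∈ G.edgeSet, D.arc e

/-- The faces of a drawing are the connected components of its complement. -/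
def IsFace (D : PlaneDrawing G) (F : Set ℂ) : Prop :=
  ∃ z ∈ D.carrierᶜ, F = connectedComponentIn D.carrierᶜ z

/-- The outer face of a drawing is the unbounded one. -/
def IsOuterFace (D : PlaneDrawing G) (F : Set ℂ) : Prop :=
  D.IsFace F ∧ ¬ Bornology.IsBounded F

end PlaneDrawing

/-- A graph is outerplanar if it has a plane drawing in which all vertices lie on the boundary of
the outer face. -/
def IsOuterplanar {V : Type u} (G : SimpleGraph V) : Prop :=
  ∃ (D : PlaneDrawing G) (F : Set ℂ), D.IsOuterFace F ∧ ∀ v : V, D.point v ∈ frontier F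

/-! ### Treedepth -/

/-- `G` has a rooted forest of depth at most `d - 1` on its vertex set such that every edge of `G`
joins a vertex to one of its ancestors or descendants. The forest on a finite set is given by its
ancestor relation `anc x y` (`x` is `y` or an ancestor of `y`), a partial order in which any two
ancestors of a vertex are comparable; a vertex with `k` ancestors, itself included, has depth
`k - 1`. -/
def HasEliminationForest {V : Type u} (G : SimpleGraph V) (d : ℕ) : Prop :=
  ∃ anc : V → V → Prop,
    (∀ x, anc x x) ∧
    (∀ x y, anc x y → anc y x → x = y) ∧
    (∀ x y z, anc x y → anc y z → anc x z) ∧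
    (∀ x y z, anc x z → anc y z → anc x y ∨ anc y x) ∧
    (∀ x y, G.Adj x y → anc x y ∨ anc y x) ∧
    (∀ z, {x | anc x z}.Finite ∧ {x | anc x z}.ncard ≤ d)

/-- The treedepth of a (finite) graph. -/
noncomputable def treedepth {V : Type u} (G : SimpleGraph V) : ℕ :=
  sInf {d | G.HasEliminationForest d}

/-- For a finite graph the minimum in the definition of treedepth is attained. -/
theorem hasEliminationForest_treedepth {V : Type u} [Finite V] (G : SimpleGraph V) :
    G.HasEliminationForest G.treedepth := by
  apply Nat.sInf_mem (s := {d | G.HasEliminationForest d})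
  obtain ⟨n, ⟨e⟩⟩ := Finite.exists_equiv_fin V
  refine ⟨Nat.card V, fun x y => e x ≤ e y, fun x => le_refl _,
    fun x y h1 h2 => e.injective (le_antisymm h1 h2), fun x y z h1 h2 => le_trans h1 h2,
    fun x y z _ _ => le_total _ _, fun x y _ => le_total _ _, fun z => ⟨Set.toFinite _, ?_⟩⟩
  exact Set.ncard_le_card _

/-! ### Fractional fragility -/

/-- A graph `G` is fractionally `f`-fragile at rate `r`, for a graph parameter `f` and a
non-decreasing non-negative function `r`: for every positive integer `a` there is a probability
distribution on the sets `X` of vertices with `f (G - X) ≤ r a` such that each vertex belongs to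
the random set with probability at most `1 / a`. -/
def IsFractionallyFragile (f : ∀ W : Type u, SimpleGraph W → ℝ) (r : ℕ → ℝ)
    {V : Type u} (G : SimpleGraph V) : Prop :=
  Monotone r ∧ (∀ a, 0 ≤ r a) ∧
    ∀ a : ℕ, 1 ≤ a → ∃ P : PMF (Set V),
      (∀ X ∈ P.support, f _ (G.induce Xᶜ) ≤ r a) ∧
      ∀ v : V, P.toOuterMeasure {X | v ∈ X} ≤ 1 / (a : ENNReal)

/-- A class of finite graphs is fractionally `f`-fragile at rate `r` if each of its members is. -/
def IsFractionallyFragileClass (C : ∀ W : Type u, SimpleGraph W → Prop)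
    (f : ∀ W : Type u, SimpleGraph W → ℝ) (r : ℕ → ℝ) : Prop :=
  ∀ (V : Type u) [Finite V] (G : SimpleGraph V), C V G → G.IsFractionallyFragile f r

/-! ### Chordal graphs, breadth-first layers, unions of paths -/

/-- A graph is chordal if all its induced cycles are triangles. -/
def IsChordal {V : Type u} (G : SimpleGraph V) : Prop :=
  ∀ (v : V) (c : G.Walk v v), c.IsCycle → c.IsChordless → c.length = 3

/-- The vertices at distance exactly `j` from `v`. -/
def bfsLayer {V : Type u} (G : SimpleGraph V) (v : V) (j : ℕ) : Set V :=
  {w | G.edist v w = j}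

/-- Every connected component is a path. -/
def IsDisjointUnionOfPaths {V : Type u} (G : SimpleGraph V) : Prop :=
  ∀ c : G.ConnectedComponent, ∃ n : ℕ, Nonempty (c.toSimpleGraph ≃g pathGraph n)

end SimpleGraph

/-!
A point of the outer face of an outerplanar drawing can be joined to every vertex without meeting
the rest of the drawing. So a `K₄` or `K₂,₃` minor of an outerplanar graph yields a drawing of the
cone over it, that is of `K₅` or `K₃,₃`, in which disjoint edges do not meet. Such drawings do not
exist: by van Kampen's argument the number of crossings between disjoint edges, counted through
winding numbers modulo 2, has an invariant parity, and it is odd for these two graphs.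

In a layering, contract everything before a layer to one vertex and each component of what comes
after it into the layer. Excluding `K₄` and `K₂,₃` makes the resulting torso of the layer a linear
forest. Now delete, with one uniformly random offset modulo `2a`, every `2a`-th layer and every
`2a`-th vertex along the torso paths of the other layers. A vertex is deleted for at most two of the
`2a` offsets. What remains has a vertex ranking whose ranks combine the residue of the layer with
the ruler ranking of paths with fewer than `2a` vertices.
-/

namespace OuterplanarFragility

open SimpleGraph

/-! ### Winding numbers and the van Kampen obstruction -/

section Winding

theorem exists_continuous_log {X : Type*} [TopologicalSpace X] [SimplyConnectedSpace X]
    [LocallyPathConnectedSpace X] (f : C(X, ℂ)) (hf : ∀ x, f x ≠ 0) :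
    ∃ g : C(X, ℂ), ∀ x, Complex.exp (g x) = f x := by
  obtain ⟨x₀⟩ : Nonempty X := inferInstance
  obtain ⟨g, ⟨-, hg⟩, -⟩ := Complex.isCoveringMapOn_exp.existsUnique_continuousMap_lifts f
    (a₀ := x₀) (e₀ := Complex.log (f x₀)) (Complex.exp_log (hf x₀)) hf
  exact ⟨g, congrFun hg⟩

/-- `D` is the change over the unit interval of a continuous logarithm of `γ - v`; its imaginary
part is the angle that `γ` sweeps as seen from `v`. -/
def IsLogChange (γ : ℝ → ℂ) (v D : ℂ) : Prop :=
  ∃ g : ℝ → ℂ, Continuous g ∧ (∀ t, Complex.exp (g t) = γ t - v) ∧ g 1 - g 0 = D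

theorem IsLogChange.unique {γ : ℝ → ℂ} {v D D' : ℂ} (h : IsLogChange γ v D)
    (h' : IsLogChange γ v D') : D = D' := by
  obtain ⟨g, hg, hgγ, rfl⟩ := h
  obtain ⟨g', hg', hgγ', rfl⟩ := h'
  have exp_sub_eq_one : Complex.exp (g 0 - g' 0) = 1 := by
    rw [Complex.exp_sub, hgγ, ← hgγ', div_self (Complex.exp_ne_zero _)]
  have eq_add_const : g = fun t => g' t + (g 0 - g' 0) := by
    refine Complex.isCoveringMap_exp.eq_of_comp_eq hg (by fun_prop) ?_ 0 (by simp)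
    funext t
    apply Subtype.ext
    simp only [Function.comp_apply, Complex.exp_add, exp_sub_eq_one, hgγ, hgγ', mul_one]
  rw [congrFun eq_add_const 1]
  ring

theorem exists_int_of_isLogChange (γ : ℝ → ℂ) {v A B : ℂ} (hA : Complex.exp A = γ 0 - v)
    (hB : Complex.exp B = γ 1 - v) :
    ∃ n : ℤ, ∀ D, IsLogChange γ v D → D = B - A + n * (2 * Real.pi * Complex.I) := by
  by_cases h : ∃ D, IsLogChange γ v D
  · obtain ⟨D, hD⟩ := h
    have exp_eq : Complex.exp D = Complex.exp (B - A) := by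
      obtain ⟨g, -, hg, rfl⟩ := hD
      rw [Complex.exp_sub, Complex.exp_sub, hg, hg, hA, hB]
    obtain ⟨n, hn⟩ := Complex.exp_eq_exp_iff_exists_int.1 exp_eq
    exact ⟨n, fun D' hD' => by rw [hD'.unique hD, hn]⟩
  · exact ⟨0, fun D hD => (h ⟨D, hD⟩).elim⟩

/-- The four changes are those of a logarithm of `γ s - δ t` along the sides of the square. -/
theorem exists_isLogChange_of_disjoint {a b c d : ℂ} (γ : Path a b) (δ : Path c d)
    (h : Disjoint (Set.range γ) (Set.range δ)) :
    ∃ D₁ D₂ D₃ D₄ : ℂ, IsLogChange γ.extend c D₁ ∧ IsLogChange δ.extend b D₂ ∧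
      IsLogChange γ.extend d D₃ ∧ IsLogChange δ.extend a D₄ ∧ D₁ + D₂ = D₃ + D₄ := by
  obtain ⟨g, hg⟩ := exists_continuous_log (X := ℝ × ℝ)
    ⟨fun x => γ.extend x.1 - δ.extend x.2, by fun_prop⟩ (by
      intro x hx
      rw [← Path.extend_range, ← Path.extend_range] at h
      exact h.ne_of_mem ⟨x.1, rfl⟩ ⟨x.2, rfl⟩ (sub_eq_zero.1 hx))
  simp only [ContinuousMap.coe_mk] at hg
  refine ⟨_, _, _, _, ⟨fun s => g (s, 0), by fun_prop, fun s => ?_, rfl⟩,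
    ⟨fun t => g (1, t) + Real.pi * Complex.I, by fun_prop, fun t => ?_, rfl⟩,
    ⟨fun s => g (s, 1), by fun_prop, fun s => ?_, rfl⟩,
    ⟨fun t => g (0, t) + Real.pi * Complex.I, by fun_prop, fun t => ?_, rfl⟩, by ring⟩
  all_goals simp [hg, Complex.exp_add]

variable {W : Type*}

theorem exists_log_sub_of_order (p : W → ℂ) {k : W → ℕ} (hk : Function.Injective k) :
    ∃ L : W → W → ℂ, (∀ u v, p u ≠ p v → Complex.exp (L u v) = p u - p v) ∧
      ∀ u v, p u ≠ p v → L u v - L v u =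
        Real.pi * Complex.I * (1 - 2 * ((if k u < k v then 1 else 0 : ℤ) : ℂ)) := by
  refine ⟨fun u v => if k u < k v then Complex.log (p u - p v)
    else Complex.log (p v - p u) + Real.pi * Complex.I, fun u v h => ?_, fun u v h => ?_⟩
  · dsimp only
    split_ifs
    · exact Complex.exp_log (sub_ne_zero.2 h)
    · rw [Complex.exp_add, Complex.exp_pi_mul_I, Complex.exp_log (sub_ne_zero.2 h.symm)]
      ring
  · rcases lt_or_gt_of_ne (hk.ne (ne_of_apply_ne p h)) with h' | h'
    all_goals
      simp only [if_pos h', if_neg (not_lt_of_gt h')]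
      push_cast
      ring

theorem exists_winding_parity (p : W → ℂ) (γ : ∀ u v, Path (p u) (p v)) {k : W → ℕ}
    (hk : Function.Injective k) :
    ∃ n : W → W → W → ZMod 2, ∀ a b c d,
      Disjoint (Set.range (γ a b)) (Set.range (γ c d)) →
        n c a b + n d a b + (n a c d + n b c d) =
          (if k a < k c then 1 else 0) + (if k a < k d then 1 else 0) +
            (if k b < k c then 1 else 0) + (if k b < k d then 1 else 0) := by
  obtain ⟨L, exp_L, L_sub_L⟩ := exists_log_sub_of_order p hk
  have exists_winding : ∀ v a b, ∃ n : ℤ, p a ≠ p v → p b ≠ p v →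
      ∀ D, IsLogChange (γ a b).extend (p v) D →
        D = L b v - L a v + n * (2 * Real.pi * Complex.I) := by
    intro v a b
    by_cases h : p a ≠ p v ∧ p b ≠ p v
    · obtain ⟨n, hn⟩ := exists_int_of_isLogChange (γ a b).extend (v := p v) (A := L a v)
        (B := L b v) (by simp [exp_L _ _ h.1]) (by simp [exp_L _ _ h.2])
      exact ⟨n, fun _ _ => hn⟩
    · exact ⟨0, fun ha hb => (h ⟨ha, hb⟩).elim⟩
  choose n hn using exists_winding
  refine ⟨fun v a b => n v a b, fun a b c d hdisj => ?_⟩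
  have hac := hdisj.ne_of_mem (γ a b).source_mem_range (γ c d).source_mem_range
  have had := hdisj.ne_of_mem (γ a b).source_mem_range (γ c d).target_mem_range
  have hbc := hdisj.ne_of_mem (γ a b).target_mem_range (γ c d).source_mem_range
  have hbd := hdisj.ne_of_mem (γ a b).target_mem_range (γ c d).target_mem_range
  have integer_relation : n c a b + n b c d - n d a b - n a c d =
      (if k b < k c then 1 else 0) - (if k a < k c then 1 else 0) -
        (if k b < k d then 1 else 0) + (if k a < k d then 1 else 0) := by
    obtain ⟨D₁, D₂, D₃, D₄, h₁, h₂, h₃, h₄, hD⟩ := exists_isLogChange_of_disjoint _ _ hdisj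
    have e₁ := hn _ _ _ hac hbc _ h₁
    have e₂ := hn _ _ _ hbc.symm hbd.symm _ h₂
    have e₃ := hn _ _ _ had hbd _ h₃
    have e₄ := hn _ _ _ hac.symm had.symm _ h₄
    apply Int.cast_injective (α := ℂ)
    apply mul_left_cancel₀ Complex.two_pi_I_ne_zero
    simp only [Int.cast_add, Int.cast_sub]
    linear_combination hD - e₁ - e₂ + e₃ + e₄ - L_sub_L b c hbc + L_sub_L a c hac +
      L_sub_L b d hbd - L_sub_L a d had
  have relation_mod_two := congrArg (Int.cast : ℤ → ZMod 2) integer_relation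
  simp only [Int.cast_add, Int.cast_sub, Int.cast_ite, Int.cast_one, Int.cast_zero,
    CharTwo.sub_eq_add] at relation_mod_two
  linear_combination relation_mod_two

end Winding

section VanKampen

variable {W : Type*}

/-- The graph has a drawing in which edges without common ends are disjoint; edges with a common end
may meet anywhere, edges may pass through vertices, and the edge `uv` is given by a set `S u v` in
which its ends are joined. This is what a plane drawing retains when it is contracted to a minor. -/
def IsWeaklyPlanar (H : SimpleGraph W) : Prop :=
  ∃ (p : W → ℂ) (S : W → W → Set ℂ), (∀ u v, H.Adj u v → JoinedIn (S u v) (p u) (p v)) ∧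
    ∀ a b c d, H.Adj a b → H.Adj c d → a ≠ c → a ≠ d → b ≠ c → b ≠ d →
      Disjoint (S a b) (S c d)

theorem IsWeaklyPlanar.of_isContained {W' : Type*} {H : SimpleGraph W} {H' : SimpleGraph W'}
    (h : H ⊑ H') (hp : IsWeaklyPlanar H') : IsWeaklyPlanar H := by
  obtain ⟨f⟩ := h
  obtain ⟨p, S, hS, hdisj⟩ := hp
  refine ⟨p ∘ f, fun u v => S (f u) (f v), fun u v huv => hS _ _ (f.toHom.map_adj huv),
    fun a b c d hab hcd hac had hbc hbd => hdisj _ _ _ _ (f.toHom.map_adj hab)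
      (f.toHom.map_adj hcd) ?_ ?_ ?_ ?_⟩
  all_goals exact f.injective.ne ‹_›

theorem sum_filter_add_comp_involution {ι M : Type*} [AddCommMonoid M] (s : Finset ι)
    (P : ι → Prop) [DecidablePred P] {σ : ι → ι} (hσ : ∀ x, σ (σ x) = x)
    (hs : ∀ x ∈ s, σ x ∈ s) (hP : ∀ x ∈ s, P (σ x) ↔ ¬P x) (f : ι → M) :
    ∑ x ∈ s with P x, (f x + f (σ x)) = ∑ x ∈ s, f x := by
  rw [Finset.sum_add_distrib, ← Finset.sum_filter_add_sum_filter_not s P f]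
  congr 1
  refine Finset.sum_bij' (fun x _ => σ x) (fun x _ => σ x) ?_ ?_ ?_ ?_ ?_
  all_goals simp only [Finset.mem_filter]
  · rintro x ⟨hx, hPx⟩
    exact ⟨hs x hx, (hP x hx).not.2 (not_not.2 hPx)⟩
  · rintro x ⟨hx, hPx⟩
    exact ⟨hs x hx, (hP x hx).2 hPx⟩
  all_goals simp [hσ]

variable [Fintype W] [DecidableEq W] (H : SimpleGraph W) [DecidableRel H.Adj]

/-- The pairs of disjoint edges `ab`, `cd` of a graph, as quadruples `(a, b, c, d)`; every pair of
edges occurs in all eight orders. -/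
def disjointEdgePairs : Finset (W × W × W × W) :=
  {q | H.Adj q.1 q.2.1 ∧ H.Adj q.2.2.1 q.2.2.2 ∧
    q.1 ≠ q.2.2.1 ∧ q.1 ≠ q.2.2.2 ∧ q.2.1 ≠ q.2.2.1 ∧ q.2.1 ≠ q.2.2.2}

variable {H}

theorem mk_mem_disjointEdgePairs {a b c d : W} : (a, b, c, d) ∈ disjointEdgePairs H ↔
    H.Adj a b ∧ H.Adj c d ∧ a ≠ c ∧ a ≠ d ∧ b ≠ c ∧ b ≠ d := by
  simp [disjointEdgePairs]

/-- Each `n c a b` occurs once for every edge at `c` that avoids `a` and `b`. -/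
theorem sum_disjointEdgePairs_eq_zero
    (heven : ∀ v a b, H.Adj a b → v ≠ a → v ≠ b →
      Even (Finset.card {w | H.Adj v w ∧ w ≠ a ∧ w ≠ b}))
    (n : W → W → W → ZMod 2) (P : W → W → Prop) [∀ a b, Decidable (P a b)] :
    ∑ q ∈ disjointEdgePairs H with P q.1 q.2.1, n q.2.2.1 q.1 q.2.1 = 0 := by
  simp only [disjointEdgePairs, Finset.filter_filter, Finset.sum_filter, Fintype.sum_prod_type]
  refine Finset.sum_eq_zero fun a _ => Finset.sum_eq_zero fun b _ =>
    Finset.sum_eq_zero fun c _ => ?_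
  by_cases h : H.Adj a b ∧ c ≠ a ∧ c ≠ b
  · obtain ⟨hab, hca, hcb⟩ := h
    by_cases hP : P a b
    · simp only [hab, hP, hca.symm, hcb.symm, ne_eq, not_false_eq_true, true_and, and_true,
        ← Finset.sum_filter, Finset.sum_const, eq_comm (a := a), eq_comm (a := b), nsmul_eq_mul]
      rw [(heven c a b hab hca hcb).natCast_zmod_two, zero_mul]
    · simp [hP]
  · refine Finset.sum_eq_zero fun d _ => if_neg ?_
    rintro ⟨⟨hab, -, hac, -, hbc, -⟩, -⟩
    exact h ⟨hab, hac.symm, hbc.symm⟩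

theorem sum_disjointEdgePairs_normalized {k : W → ℕ} (hk : Function.Injective k)
    (n : W → W → W → ZMod 2) :
    ∑ q ∈ disjointEdgePairs H with k q.1 < k q.2.1, n q.2.2.1 q.1 q.2.1 =
      ∑ q ∈ disjointEdgePairs H with
          (k q.1 < k q.2.1 ∧ k q.2.2.1 < k q.2.2.2) ∧ k q.1 < k q.2.2.1,
        (n q.2.2.1 q.1 q.2.1 + n q.2.2.2 q.1 q.2.1 +
          (n q.1 q.2.2.1 q.2.2.2 + n q.2.1 q.2.2.1 q.2.2.2)) := by
  have lt_iff {u v : W} (h : u ≠ v) : k v < k u ↔ ¬k u < k v := by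
    have := hk.ne h
    lia
  rw [← sum_filter_add_comp_involution _ (fun q => k q.2.2.1 < k q.2.2.2)
    (σ := fun q => (q.1, q.2.1, q.2.2.2, q.2.2.1)) (fun _ => rfl), Finset.filter_filter,
    ← sum_filter_add_comp_involution _ (fun q => k q.1 < k q.2.2.1)
    (σ := fun q => (q.2.2.1, q.2.2.2, q.1, q.2.1)) (fun _ => rfl), Finset.filter_filter]
  all_goals
    rintro ⟨a, b, c, d⟩
    simp only [Finset.mem_filter, mk_mem_disjointEdgePairs]
  · rintro ⟨⟨hab, hcd, hac, had, hbc, hbd⟩, hk⟩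
    exact ⟨⟨hcd, hab, hac.symm, hbc.symm, had.symm, hbd.symm⟩, hk.symm⟩
  · rintro ⟨⟨-, -, hac, -⟩, -⟩
    exact lt_iff hac
  · rintro ⟨⟨hab, hcd, hac, had, hbc, hbd⟩, hk⟩
    exact ⟨⟨hab, hcd.symm, had, hac, hbd, hbc⟩, hk⟩
  · rintro ⟨⟨-, hcd, -⟩, -⟩
    exact lt_iff hcd.ne

/-- Summing the winding parities over all pairs of disjoint edges shows that the number of pairs of
edges crossing in a drawing with the vertices on a line and the edges above it has to be even. -/
theorem not_isWeaklyPlanar_of_odd_crossings {k : W → ℕ} (hk : Function.Injective k)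
    (heven : ∀ v a b, H.Adj a b → v ≠ a → v ≠ b →
      Even (Finset.card {w | H.Adj v w ∧ w ≠ a ∧ w ≠ b}))
    (hodd : Odd (Finset.card {q : W × W × W × W | H.Adj q.1 q.2.1 ∧ H.Adj q.2.2.1 q.2.2.2 ∧
      k q.1 < k q.2.2.1 ∧ k q.2.2.1 < k q.2.1 ∧ k q.2.1 < k q.2.2.2})) :
    ¬IsWeaklyPlanar H := by
  rintro ⟨p, S, hS, hdisj⟩
  have exists_path (u v) : ∃ γ : _root_.Path (p u) (p v), H.Adj u v → Set.range γ ⊆ S u v := by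
    by_cases h : H.Adj u v
    · exact ⟨(hS u v h).somePath, fun _ => Set.range_subset_iff.2 (hS u v h).somePath_mem⟩
    · exact ⟨PathConnectedSpace.somePath _ _, fun h' => (h h').elim⟩
  choose γ hγ using exists_path
  obtain ⟨n, hn⟩ := exists_winding_parity p γ hk
  have sum_eq_zero := sum_disjointEdgePairs_eq_zero heven n fun a b => k a < k b
  refine ZMod.natCast_ne_zero_iff_odd.2 hodd (Eq.trans ?_ sum_eq_zero)
  rw [sum_disjointEdgePairs_normalized hk, Finset.cast_card, Finset.sum_filter, Finset.sum_filter,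
    disjointEdgePairs, Finset.sum_filter]
  refine Finset.sum_congr rfl fun ⟨a, b, c, d⟩ _ => ?_
  have ne_iff {u v : W} : u ≠ v ↔ k u ≠ k v := hk.ne_iff.symm
  by_cases hq : H.Adj a b ∧ H.Adj c d ∧ a ≠ c ∧ a ≠ d ∧ b ≠ c ∧ b ≠ d
  · obtain ⟨hab, hcd, hac, had, hbc, hbd⟩ := hq
    have relation := hn a b c d
      ((hdisj a b c d hab hcd hac had hbc hbd).mono (hγ a b hab) (hγ c d hcd))
    simp only [hab, hcd, hac, had, hbc, hbd, relation, ne_eq, not_false_eq_true, and_true, true_and,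
      if_true]
    rw [ne_iff] at hac had hbc hbd
    split_ifs <;> first | lia | decide
  · rw [if_neg hq, if_neg]
    rintro ⟨hab, hcd, hac, hcb, hbd⟩
    simp only [ne_iff] at hq
    exact hq ⟨hab, hcd, by lia, by lia, by lia, by lia⟩

theorem not_isWeaklyPlanar_top_five : ¬IsWeaklyPlanar (⊤ : SimpleGraph (Fin 5)) :=
  not_isWeaklyPlanar_of_odd_crossings Fin.val_injective (by decide) (by decide +kernel)

instance {α β : Type*} : DecidableRel (completeBipartiteGraph α β).Adj :=
  fun _ _ => inferInstanceAs (Decidable (_ ∨ _))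

theorem not_isWeaklyPlanar_completeBipartite_three :
    ¬IsWeaklyPlanar (completeBipartiteGraph (Fin 3) (Fin 3)) :=
  not_isWeaklyPlanar_of_odd_crossings
    (k := Sum.elim (fun i => (i : ℕ)) fun j => 3 + j) (by decide) (by decide) (by decide +kernel)

end VanKampen

/-! ### Minors and cones -/

section Within

variable {V W : Type*} {G : SimpleGraph V} {A : Set V} {x y : V}

theorem prop_of_reachable {P : V → Prop} (hP : ∀ a b, G.Adj a b → P a → P b)
    (h : G.Reachable x y) (hx : P x) : P y := by
  obtain ⟨w⟩ := h
  induction w with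
  | nil => exact hx
  | cons hab _ ih => exact ih (hP _ _ hab hx)

/-- The graph on the vertex set of `G` formed by the edges inside `A`. Reachability in it speaks
about walks of `G` inside `A` without passing to a subtype. -/
def within (G : SimpleGraph V) (A : Set V) : SimpleGraph V :=
  (G.induce A).spanningCoe

theorem within_adj : (within G A).Adj x y ↔ G.Adj x y ∧ x ∈ A ∧ y ∈ A := by
  simp [within]

theorem within_mono {B : Set V} (h : A ⊆ B) : within G A ≤ within G B := fun _ _ hab => by
  rw [within_adj] at hab ⊢
  exact ⟨hab.1, h hab.2.1, h hab.2.2⟩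

theorem within_le : within G A ≤ G := fun _ _ hab => (within_adj.1 hab).1

theorem mem_of_reachable_within (h : (within G A).Reachable x y) (hx : x ∈ A) : y ∈ A :=
  prop_of_reachable (fun _ _ hab _ => (within_adj.1 hab).2.2) h hx

theorem reachable_within_map {G' : SimpleGraph W} {A' : Set W} (f : V → W)
    (hf : ∀ a ∈ A, ∀ b ∈ A, G.Adj a b → (within G' A').Reachable (f a) (f b))
    (h : (within G A).Reachable x y) : (within G' A').Reachable (f x) (f y) :=
  prop_of_reachable (P := fun z => (within G' A').Reachable (f x) (f z))
    (fun a b hab ha => ha.trans <| by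
      obtain ⟨hab, ha, hb⟩ := within_adj.1 hab
      exact hf a ha b hb hab) h (Reachable.refl _)

theorem reachable_induce_iff_within (hx : x ∈ A) (hy : y ∈ A) :
    (G.induce A).Reachable ⟨x, hx⟩ ⟨y, hy⟩ ↔ (within G A).Reachable x y := by
  refine ⟨fun h => ?_, fun h => ?_⟩
  · exact h.map (Embedding.spanningCoe (G.induce A)).toHom
  · suffices ∃ hy' : y ∈ A, (G.induce A).Reachable ⟨x, hx⟩ ⟨y, hy'⟩ from this.2
    refine prop_of_reachable (P := fun z => ∃ hz : z ∈ A, (G.induce A).Reachable ⟨x, hx⟩ ⟨z, hz⟩)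
      (fun a b hab => ?_) h ⟨hx, Reachable.refl _⟩
    rintro ⟨ha, hreach⟩
    have hb := (within_adj.1 hab).2.2
    exact ⟨hb, hreach.trans (Adj.reachable (G := G.induce A) (u := ⟨a, ha⟩) (v := ⟨b, hb⟩)
      (within_adj.1 hab).1)⟩

theorem connected_induce_iff_within : (G.induce A).Connected ↔
    A.Nonempty ∧ ∀ x ∈ A, ∀ y ∈ A, (within G A).Reachable x y := by
  rw [connected_iff, and_comm, Set.nonempty_coe_sort]
  refine and_congr_right fun _ => ⟨fun h x hx y hy => ?_, fun h x y => ?_⟩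
  · exact (reachable_induce_iff_within hx hy).1 (h _ _)
  · exact (reachable_induce_iff_within x.2 y.2).2 (h _ x.2 _ y.2)

theorem connected_induce_of_reachable (hx : x ∈ A) (h : ∀ y ∈ A, (within G A).Reachable x y) :
    (G.induce A).Connected :=
  connected_induce_iff_within.2 ⟨⟨x, hx⟩, fun y hy z hz => (h y hy).symm.trans (h z hz)⟩

theorem reachable_within_class (h : (within G A).Reachable x y) :
    (within G {z | (within G A).Reachable x z}).Reachable x y := by
  suffices (within G A).Reachable x y ∧ (within G {z | (within G A).Reachable x z}).Reachable x y
    from this.2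
  refine prop_of_reachable (P := fun w => (within G A).Reachable x w ∧
    (within G {z | (within G A).Reachable x z}).Reachable x w) (fun a b hab => ?_) h
    ⟨Reachable.refl x, Reachable.refl x⟩
  rintro ⟨ha, ha'⟩
  have hb := ha.trans hab.reachable
  exact ⟨hb, ha'.trans (within_adj.2 ⟨within_le hab, ha, hb⟩).reachable⟩

end Within

section Minor

variable {U V W : Type*} {K : SimpleGraph U} {G : SimpleGraph V} {H : SimpleGraph W}

/-- `H` is a minor of `G`: the vertices of `H` can be represented by disjoint connected sets of
vertices of `G` (the branch sets) such that the branch sets of adjacent vertices are joined by an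
edge. Equivalently, `H` arises from a subgraph of `G` by contracting edges. -/
def IsMinor (H : SimpleGraph W) (G : SimpleGraph V) : Prop :=
  ∃ B : W → Set V, (∀ i, (G.induce (B i)).Connected) ∧
    Pairwise (fun i j => Disjoint (B i) (B j)) ∧
    ∀ i j, H.Adj i j → ∃ a ∈ B i, ∃ b ∈ B j, G.Adj a b

theorem IsMinor.of_isContained (h : H ⊑ G) : IsMinor H G := by
  obtain ⟨f⟩ := h
  refine ⟨fun i => {f i}, fun i => Connected.of_subsingleton, fun i j hij => ?_,
    fun i j hij => ⟨_, rfl, _, rfl, f.toHom.map_adj hij⟩⟩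
  exact Set.disjoint_singleton.2 (f.injective.ne hij)

theorem connected_induce_biUnion {A : Set W} {B : W → Set V} (hA : (H.induce A).Connected)
    (hB : ∀ i, (G.induce (B i)).Connected)
    (hadj : ∀ i j, H.Adj i j → ∃ a ∈ B i, ∃ b ∈ B j, G.Adj a b) :
    (G.induce (⋃ i ∈ A, B i)).Connected := by
  have reach_of_mem_branch {i a b} (hi : i ∈ A) (ha : a ∈ B i) (hb : b ∈ B i) :
      (within G (⋃ i ∈ A, B i)).Reachable a b :=
    ((connected_induce_iff_within.1 (hB i)).2 a ha b hb).mono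
      (within_mono (Set.subset_biUnion_of_mem hi))
  obtain ⟨⟨i₀, hi₀⟩, reach_index⟩ := connected_induce_iff_within.1 hA
  obtain ⟨x₀, hx₀⟩ := (connected_induce_iff_within.1 (hB i₀)).1
  refine connected_induce_of_reachable (Set.mem_biUnion hi₀ hx₀) fun y hy => ?_
  obtain ⟨i, hi, hyi⟩ := Set.mem_iUnion₂.1 hy
  refine prop_of_reachable
    (P := fun i => ∀ y ∈ B i, (within G (⋃ i ∈ A, B i)).Reachable x₀ y) (fun i j hij ih y hy => ?_)
    (reach_index i₀ hi₀ i hi) (fun y hy => reach_of_mem_branch hi₀ hx₀ hy) y hyi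
  obtain ⟨hij, hi, hj⟩ := within_adj.1 hij
  obtain ⟨a, ha, b, hb, hab⟩ := hadj i j hij
  have hab' : (within G (⋃ i ∈ A, B i)).Adj a b :=
    within_adj.2 ⟨hab, Set.mem_biUnion hi ha, Set.mem_biUnion hj hb⟩
  exact ((ih a ha).trans hab'.reachable).trans (reach_of_mem_branch hj hb hy)

theorem IsMinor.trans (hHG : IsMinor H G) (hGK : IsMinor G K) : IsMinor H K := by
  obtain ⟨B, hB, hBdisj, hBadj⟩ := hHG
  obtain ⟨C, hC, hCdisj, hCadj⟩ := hGK
  refine ⟨fun i => ⋃ a ∈ B i, C a, fun i => connected_induce_biUnion (hB i) hC hCadj,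
    fun i j hij => ?_, fun i j hij => ?_⟩
  · simp only [Set.disjoint_iUnion_left, Set.disjoint_iUnion_right]
    exact fun a ha b hb => hCdisj ((hBdisj hij).ne_of_mem hb ha)
  · obtain ⟨a, ha, b, hb, hab⟩ := hBadj i j hij
    obtain ⟨x, hx, y, hy, hxy⟩ := hCadj a b hab
    exact ⟨x, Set.mem_biUnion ha hx, y, Set.mem_biUnion hb hy, hxy⟩

/-- The graph obtained from `H` by adding an apex vertex `none` adjacent to all vertices of `H`. -/
def cone (H : SimpleGraph W) : SimpleGraph (Option W) where
  Adj
    | none, none => False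
    | none, some _ => True
    | some _, none => True
    | some a, some b => H.Adj a b
  symm := ⟨by rintro (_ | _) (_ | _) <;> simp [H.adj_comm]⟩
  loopless := ⟨by rintro (_ | _) <;> simp⟩

@[simp] theorem cone_adj_none_some (H : SimpleGraph W) (a : W) : (cone H).Adj none (some a) :=
  trivial

@[simp] theorem cone_adj_some_none (H : SimpleGraph W) (a : W) : (cone H).Adj (some a) none :=
  trivial

@[simp] theorem cone_adj_some_some {a b : W} : (cone H).Adj (some a) (some b) ↔ H.Adj a b :=
  Iff.rfl

@[simp] theorem not_cone_adj_none_none : ¬(cone H).Adj none none :=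
  fun h => h

theorem IsMinor.cone (h : IsMinor H G) : IsMinor (cone H) (cone G) := by
  obtain ⟨B, hB, hdisj, hadj⟩ := h
  refine ⟨fun i => i.elim {none} fun i => some '' B i, ?_, ?_, ?_⟩
  · rintro (_ | i)
    · exact Connected.of_subsingleton (G := (OuterplanarFragility.cone G).induce {none})
    · obtain ⟨hne, hreach⟩ := connected_induce_iff_within.1 (hB i)
      refine connected_induce_iff_within.2 ⟨hne.image some, ?_⟩
      rintro _ ⟨x, hx, rfl⟩ _ ⟨y, hy, rfl⟩
      refine reachable_within_map some (fun a ha b hb hab => Adj.reachable ?_) (hreach x hx y hy)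
      exact within_adj.2 ⟨hab, Set.mem_image_of_mem _ ha, Set.mem_image_of_mem _ hb⟩
  · rintro (_ | i) (_ | j) hij
    · exact (hij rfl).elim
    · simp
    · simp
    · exact (Set.disjoint_image_iff (Option.some_injective V)).2 (hdisj (by simpa using hij))
  · rintro (_ | i) (_ | j) hij
    · exact (not_cone_adj_none_none hij).elim
    · obtain ⟨b, hb⟩ := (connected_induce_iff_within.1 (hB j)).1
      exact ⟨none, rfl, some b, Set.mem_image_of_mem _ hb, trivial⟩
    · obtain ⟨a, ha⟩ := (connected_induce_iff_within.1 (hB i)).1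
      exact ⟨some a, Set.mem_image_of_mem _ ha, none, rfl, trivial⟩
    · obtain ⟨a, ha, b, hb, hab⟩ := hadj i j hij
      exact ⟨some a, Set.mem_image_of_mem _ ha, some b, Set.mem_image_of_mem _ hb, hab⟩

theorem top_isContained_cone (n : ℕ) :
    (⊤ : SimpleGraph (Fin (n + 1))) ⊑ cone (⊤ : SimpleGraph (Fin n)) := by
  refine ⟨⟨⟨finSuccEquiv n, fun {i j} hij => ?_⟩, (finSuccEquiv n).injective⟩⟩
  cases i using Fin.cases <;> cases j using Fin.cases <;> simp_all

theorem completeBipartiteGraph_isContained_cone (m : ℕ) (β : Type*) :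
    completeBipartiteGraph (Fin (m + 1)) β ⊑ cone (completeBipartiteGraph (Fin m) β) := by
  refine ⟨⟨⟨Sum.elim (fun i => (finSuccEquiv m i).map Sum.inl) fun j => some (.inr j),
    fun {x y} hxy => ?_⟩, ?_⟩⟩
  · rcases x with i | j <;> rcases y with i' | j' <;> simp_all
    · cases i using Fin.cases <;> simp_all
    · cases i' using Fin.cases <;> simp_all
  · rintro (i | j) (i' | j') h
    · exact congrArg _ ((finSuccEquiv m).injective (Option.map_injective Sum.inl_injective h))
    · cases i using Fin.cases <;> simp_all
    · cases i' using Fin.cases <;> simp_all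
    · simp_all

theorem completeBipartiteGraph_isContained_cone_of_adj {v a b c : W} (ha : H.Adj v a)
    (hb : H.Adj v b) (hc : H.Adj v c) (hab : a ≠ b) (hac : a ≠ c) (hbc : b ≠ c) :
    completeBipartiteGraph (Fin 2) (Fin 3) ⊑ cone H := by
  refine ⟨⟨⟨Sum.elim ![none, some v] ![some a, some b, some c], fun {x y} hxy => ?_⟩, ?_⟩⟩
  · rcases x with i | j <;> rcases y with i' | j'
    · simp at hxy
    · fin_cases i <;> fin_cases j' <;> simp [*]
    · fin_cases i' <;> fin_cases j <;> simp [*, H.adj_comm _ v]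
    · simp at hxy
  · have := ha.ne; have := hb.ne; have := hc.ne
    rintro (i | j) (i' | j') h
    · fin_cases i <;> fin_cases i' <;> simp_all
    · fin_cases i <;> fin_cases j' <;> simp_all
    · fin_cases j <;> fin_cases i' <;> simp_all
    · fin_cases j <;> fin_cases j' <;> simp_all

end Minor

/-! ### Outerplanar graphs have no `K₄` and no `K₂,₃` minor -/

section Drawing

variable {V : Type u} {G : SimpleGraph V} (D : PlaneDrawing G) {A B : Set V} {x y v : V}

/-- The part of the plane covered by the drawing of the subgraph induced by `A`. -/
def region (A : Set V) : Set ℂ :=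
  D.point '' A ∪ ⋃ e ∈ {e ∈ G.edgeSet | ∀ v ∈ e, v ∈ A}, D.arc e

theorem point_mem_region (hv : v ∈ A) : D.point v ∈ region D A :=
  Or.inl ⟨v, hv, rfl⟩

theorem arc_subset_region (hxy : G.Adj x y) (hx : x ∈ A) (hy : y ∈ A) :
    D.arc s(x, y) ⊆ region D A :=
  (Set.subset_biUnion_of_mem (u := D.arc)
    (show s(x, y) ∈ {e ∈ G.edgeSet | ∀ v ∈ e, v ∈ A} by simp [hxy, hx, hy])).trans
    Set.subset_union_right

theorem region_mono (h : A ⊆ B) : region D A ⊆ region D B :=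
  Set.union_subset_union (Set.image_mono h)
    (Set.biUnion_subset_biUnion_left fun _ he => ⟨he.1, fun v hv => h (he.2 v hv)⟩)

theorem region_subset_carrier : region D A ⊆ D.carrier :=
  Set.union_subset_union (Set.image_subset_range _ _)
    (Set.biUnion_subset_biUnion_left fun _ he => he.1)

theorem disjoint_region (h : Disjoint A B) : Disjoint (region D A) (region D B) := by
  have disjoint_of_mem {v} (hA : v ∈ A) (hB : v ∈ B) : False := h.ne_of_mem hA hB rfl
  rw [Set.disjoint_left]
  simp only [region, Set.mem_union, Set.mem_image, Set.mem_iUnion₂]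
  rintro z (⟨a, ha, rfl⟩ | ⟨e, ⟨he, heA⟩, hze⟩) (⟨b, hb, hz⟩ | ⟨f, ⟨hf, hfB⟩, hzf⟩)
  · exact disjoint_of_mem ha (D.point_injective hz ▸ hb)
  · exact disjoint_of_mem ha (hfB a (D.point_mem_arc f hf a hzf))
  · exact disjoint_of_mem (heA b (D.point_mem_arc e he b (hz ▸ hze))) hb
  · by_cases hef : e = f
    · subst hef
      induction e with | h x y => exact disjoint_of_mem (heA x (by simp)) (hfB x (by simp))
    · obtain ⟨w, hwe, hwf, -⟩ := D.arc_inter_arc e he f hf hef z ⟨hze, hzf⟩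
      exact disjoint_of_mem (heA w hwe) (hfB w hwf)

theorem isClosed_region [Finite V] : IsClosed (region D A) := by
  refine (Set.toFinite A |>.image D.point).isClosed.union
    (Set.Finite.isClosed_biUnion (Set.toFinite _) fun e he => ?_)
  induction e with
  | h x y =>
    obtain ⟨γ, -, hγ⟩ := D.isArc x y he.1
    exact hγ ▸ (isCompact_range γ.continuous).isClosed

theorem joinedIn_region_of_reachable (hx : x ∈ A) (h : (within G A).Reachable x y) :
    JoinedIn (region D A) (D.point x) (D.point y) := by
  refine prop_of_reachable (P := fun z => JoinedIn (region D A) (D.point x) (D.point z))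
    (fun a b hab ha => ?_) h (JoinedIn.refl (point_mem_region D hx))
  obtain ⟨hab, hA⟩ := within_adj.1 hab
  obtain ⟨γ, -, hγ⟩ := D.isArc a b hab
  exact ha.trans ⟨γ, fun t => arc_subset_region D hab hA.1 hA.2 (hγ ▸ Set.mem_range_self t)⟩

theorem joinedIn_region_union {a b : V} (hA : (G.induce A).Connected)
    (hB : (G.induce B).Connected) (ha : a ∈ A) (hb : b ∈ B) (h : ∃ x ∈ A, ∃ y ∈ B, G.Adj x y) :
    JoinedIn (region D (A ∪ B)) (D.point a) (D.point b) := by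
  obtain ⟨x, hx, y, hy, hxy⟩ := h
  have hAB := connected_induce_union hA.preconnected hB.preconnected hx hy hxy
  exact joinedIn_region_of_reachable D (Or.inl ha)
    ((connected_induce_iff_within.1 hAB).2 a (Or.inl ha) b (Or.inr hb))

/-- The complement of the drawing of `G - v` is an open set that contains every face and the point
of `v`, so a point of a face is joined to every vertex on its boundary without meeting the rest of
the drawing. -/
theorem joinedIn_compl_region_of_mem_frontier [Finite V] {z : ℂ} {F : Set ℂ} (hF : D.IsFace F)
    (hz : z ∈ F) (hv : D.point v ∈ frontier F) :
    JoinedIn (region D {v}ᶜ)ᶜ z (D.point v) := by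
  obtain ⟨w, -, rfl⟩ := hF
  have hopen : IsOpen (region D {v}ᶜ)ᶜ := (isClosed_region D).isOpen_compl
  have insert_subset : insert (D.point v) (connectedComponentIn D.carrierᶜ w) ⊆
      (region D {v}ᶜ)ᶜ := by
    refine Set.insert_subset ?_ ((connectedComponentIn_subset _ _).trans
      (Set.compl_subset_compl.2 (region_subset_carrier D)))
    exact (disjoint_region D disjoint_compl_right).notMem_of_mem_left
      (point_mem_region D (Set.mem_singleton v))
  have insert_preconnected :
      IsPreconnected (insert (D.point v) (connectedComponentIn D.carrierᶜ w)) :=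
    isPreconnected_connectedComponentIn.subset_closure (Set.subset_insert _ _)
      (Set.insert_subset (frontier_subset_closure hv) subset_closure)
  have subset_component := insert_preconnected.subset_connectedComponentIn
    (Set.mem_insert_of_mem _ hz) insert_subset
  have component_pathConnected :
      IsPathConnected (connectedComponentIn (region D {v}ᶜ)ᶜ z) :=
    hopen.connectedComponentIn.isConnected_iff_isPathConnected.1
      (isConnected_connectedComponentIn_iff.2 (insert_subset (Set.mem_insert_of_mem _ hz)))
  exact (component_pathConnected.joinedIn z (subset_component (Set.mem_insert_of_mem _ hz)) _
    (subset_component (Set.mem_insert _ _))).mono (connectedComponentIn_subset _ _)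

theorem disjoint_region_union {A' B' : Set V} (h₁ : Disjoint A A') (h₂ : Disjoint A B')
    (h₃ : Disjoint B A') (h₄ : Disjoint B B') :
    Disjoint (region D (A ∪ B)) (region D (A' ∪ B')) :=
  disjoint_region D <| Set.disjoint_union_left.2
    ⟨Set.disjoint_union_right.2 ⟨h₁, h₂⟩, Set.disjoint_union_right.2 ⟨h₃, h₄⟩⟩

/-- The apex of the cone is drawn inside the outer face. -/
theorem isWeaklyPlanar_cone_of_isMinor [Finite V] {W : Type*} {H : SimpleGraph W}
    (hG : G.IsOuterplanar) (h : IsMinor H G) : IsWeaklyPlanar (cone H) := by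
  obtain ⟨D, F, ⟨hF, -⟩, hfrontier⟩ := hG
  obtain ⟨B, hB, hdisj, hadj⟩ := h
  choose b hb using fun i => (connected_induce_iff_within.1 (hB i)).1
  obtain ⟨z, hz⟩ : F.Nonempty := by
    obtain ⟨w, hw, rfl⟩ := hF
    exact ⟨w, mem_connectedComponentIn hw⟩
  let S : Option W → Option W → Set ℂ
    | none, none => ∅
    | none, some i => (region D {b i}ᶜ)ᶜ
    | some i, none => (region D {b i}ᶜ)ᶜ
    | some i, some j => region D (B i ∪ B j)
  have branch_disjoint {i j} (h : some i ≠ some j) : Disjoint (B i) (B j) :=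
    hdisj (ne_of_apply_ne some h)
  have apex_disjoint {i j l} (hj : some i ≠ some j) (hl : some i ≠ some l) :
      Disjoint (region D {b i}ᶜ)ᶜ (region D (B j ∪ B l)) := by
    refine disjoint_compl_left.mono_right (region_mono D (Set.subset_compl_singleton_iff.2 ?_))
    exact Set.disjoint_left.1
      (Set.disjoint_union_right.2 ⟨branch_disjoint hj, branch_disjoint hl⟩) (hb i)
  refine ⟨fun i => i.elim z fun i => D.point (b i), S, ?_, ?_⟩
  · rintro (_ | i) (_ | j) hij
    · exact (not_cone_adj_none_none hij).elim
    · exact joinedIn_compl_region_of_mem_frontier D hF hz (hfrontier _)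
    · exact (joinedIn_compl_region_of_mem_frontier D hF hz (hfrontier _)).symm
    · exact joinedIn_region_union D (hB i) (hB j) (hb i) (hb j) (hadj i j hij)
  · rintro (_ | i) (_ | j) (_ | l) (_ | m) hij hlm h₁ h₂ h₃ h₄
    all_goals first
      | exact (not_cone_adj_none_none ‹_›).elim
      | exact absurd rfl ‹(none : Option W) ≠ none›
      | exact apex_disjoint h₃ h₄
      | exact apex_disjoint h₁ h₂
      | exact (apex_disjoint h₂.symm h₄.symm).symm
      | exact (apex_disjoint h₁.symm h₃.symm).symm
      | exact disjoint_region_union D (branch_disjoint h₁) (branch_disjoint h₂)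
          (branch_disjoint h₃) (branch_disjoint h₄)

theorem not_isMinor_top_four [Finite V] (hG : G.IsOuterplanar) :
    ¬IsMinor (⊤ : SimpleGraph (Fin 4)) G := fun h =>
  not_isWeaklyPlanar_top_five
    ((isWeaklyPlanar_cone_of_isMinor hG h).of_isContained (top_isContained_cone 4))

theorem not_isMinor_completeBipartite_two_three [Finite V] (hG : G.IsOuterplanar) :
    ¬IsMinor (completeBipartiteGraph (Fin 2) (Fin 3)) G := fun h =>
  not_isWeaklyPlanar_completeBipartite_three
    ((isWeaklyPlanar_cone_of_isMinor hG h).of_isContained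
      (completeBipartiteGraph_isContained_cone 2 (Fin 3)))

end Drawing

/-! ### Linear forests -/

section LinearForest

variable {V W : Type*} {G : SimpleGraph V} {H : SimpleGraph W}

/-- A linear forest is an acyclic graph without vertices of degree three or more. For finite graphs
these are the disjoint unions of paths. -/
def IsLinearForest (G : SimpleGraph V) : Prop :=
  G.IsAcyclic ∧ ∀ v a b c, G.Adj v a → G.Adj v b → G.Adj v c → a = b ∨ a = c ∨ b = c

theorem IsLinearForest.comap (hH : IsLinearForest H) (f : G →g H) (hf : Function.Injective f) :
    IsLinearForest G := by
  refine ⟨hH.1.comap f hf, fun v a b c ha hb hc => ?_⟩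
  simpa only [hf.eq_iff] using
    hH.2 (f v) (f a) (f b) (f c) (f.map_adj ha) (f.map_adj hb) (f.map_adj hc)

theorem isMinor_top_three_of_not_isAcyclic (h : ¬G.IsAcyclic) :
    IsMinor (⊤ : SimpleGraph (Fin 3)) G := by
  simp only [IsAcyclic, not_forall, not_not] at h
  obtain ⟨u, c, hc⟩ := h
  obtain ⟨w, x, y, huw, hxw, huy, p, hup, hwp, huw'⟩ : ∃ (w x y : V) (_ : G.Adj u w) (_ : G.Adj w x)
      (_ : G.Adj u y) (p : G.Walk x y), u ∉ p.support ∧ w ∉ p.support ∧ u ≠ w := by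
    cases c with
    | nil => exact (hc.ne_nil rfl).elim
    | @cons _ w _ huw p =>
    obtain ⟨hp, huwp⟩ := (Walk.cons_isCycle_iff _ _).1 hc
    cases p with
    | nil => exact (huw.ne rfl).elim
    | @cons _ x _ hwx p =>
    obtain ⟨hp, hwp⟩ := (Walk.cons_isPath_iff _ _).1 hp
    cases p using Walk.concatRec with
    | Hnil => simp [Sym2.eq_swap] at huwp
    | Hconcat p hyu =>
      rw [Walk.concat_isPath_iff] at hp
      rw [Walk.support_concat, List.mem_append, not_or] at hwp
      exact ⟨w, x, _, huw, hwx, hyu.symm, p, hp.2, hwp.1, huw.ne⟩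
  refine ⟨![{u}, {w}, {z | z ∈ p.support}], fun i => ?_, fun i j hij => ?_, fun i j hij => ?_⟩
  · fin_cases i
    exacts [.of_subsingleton (G := G.induce {u}), .of_subsingleton (G := G.induce {w}),
      p.connected_induce_support]
  · fin_cases i <;> fin_cases j <;> simp [*, huw'.symm] at hij ⊢
  · fin_cases i <;> fin_cases j <;> first
      | exact absurd rfl hij
      | exact ⟨u, rfl, w, rfl, huw⟩
      | exact ⟨u, rfl, y, p.end_mem_support, huy⟩
      | exact ⟨w, rfl, u, rfl, huw.symm⟩
      | exact ⟨w, rfl, x, p.start_mem_support, hxw⟩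
      | exact ⟨y, p.end_mem_support, u, rfl, huy.symm⟩
      | exact ⟨x, p.start_mem_support, w, rfl, hxw.symm⟩

theorem isLinearForest_of_not_isMinor_cone
    (hK₄ : ¬IsMinor (⊤ : SimpleGraph (Fin 4)) (cone G))
    (hK₂₃ : ¬IsMinor (completeBipartiteGraph (Fin 2) (Fin 3)) (cone G)) :
    IsLinearForest G := by
  refine ⟨?_, fun v a b c ha hb hc => ?_⟩
  · contrapose! hK₄
    exact (IsMinor.of_isContained (top_isContained_cone 3)).trans
      (isMinor_top_three_of_not_isAcyclic hK₄).cone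
  · contrapose! hK₂₃
    obtain ⟨hab, hac, hbc⟩ := hK₂₃
    exact .of_isContained (completeBipartiteGraph_isContained_cone_of_adj ha hb hc hab hac hbc)

/-- The neighbours of an inner vertex of a longest path are its two neighbours on the path, and an
end vertex cannot have a further neighbour because the path is longest. -/
theorem IsLinearForest.mem_support_of_adj (hG : IsLinearForest G) {u v : V} {p : G.Walk u v}
    (hp : p.IsPath) (hmax : ∀ (u' v' : V) (q : G.Walk u' v'), q.IsPath → q.length ≤ p.length)
    {x y : V} (hxy : G.Adj x y) (hx : x ∈ p.support) : y ∈ p.support := by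
  by_contra hy
  obtain ⟨i, rfl, hi⟩ := Walk.mem_support_iff_exists_getVert.1 hx
  rcases Nat.eq_zero_or_pos i with rfl | hi₀
  · rw [Walk.getVert_zero] at hxy
    exact (hmax _ _ _ (hp.cons (h := hxy.symm) hy)).not_gt (by simp)
  rcases hi.eq_or_lt with rfl | hi
  · rw [Walk.getVert_length] at hxy
    exact (hmax _ _ _ (hp.concat hy hxy)).not_gt (by simp)
  obtain ⟨i, rfl⟩ := Nat.exists_eq_succ_of_ne_zero hi₀.ne'
  have notMem_path (k) : p.getVert k ≠ y := fun h => hy (h ▸ p.getVert_mem_support k)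
  rcases hG.2 _ _ _ _ (p.adj_getVert_succ (i := i) (by omega)).symm (p.adj_getVert_succ hi) hxy
    with h | h | h
  · have := hp.getVert_injOn (show i ≤ p.length by omega) (show i + 2 ≤ p.length by omega) h
    omega
  · exact notMem_path _ h
  · exact notMem_path _ h

theorem exists_isPath_support_eq_univ [Finite V] (hG : IsLinearForest G) (hconn : G.Connected) :
    ∃ (u v : V) (p : G.Walk u v), p.IsPath ∧ ∀ x, x ∈ p.support := by
  have := hconn.nonempty
  obtain ⟨u, v, p, hp, hmax⟩ := Walk.exists_isPath_forall_isPath_length_le_length G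
  exact ⟨u, v, p, hp, fun x => prop_of_reachable (P := (· ∈ p.support))
    (fun a b hab ha => hG.mem_support_of_adj hp hmax hab ha) (hconn u x) p.start_mem_support⟩

theorem getVert_adj_getVert_iff (hG : G.IsAcyclic) {u v : V} {p : G.Walk u v} (hp : p.IsPath)
    {i j : ℕ} (hi : i ≤ p.length) (hj : j ≤ p.length) :
    G.Adj (p.getVert i) (p.getVert j) ↔ i + 1 = j ∨ j + 1 = i := by
  wlog hij : i ≤ j generalizing i j
  · rw [G.adj_comm, or_comm, this hj hi (le_of_not_ge hij)]
  refine ⟨fun h => .inl ?_, fun h => ?_⟩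
  · have getVert_mem : p.getVert j ∈ (p.drop i).support := by
      rw [Walk.mem_support_iff_exists_getVert]
      exact ⟨j - i, by rw [Walk.drop_getVert, Nat.add_sub_cancel' hij],
        by rw [Walk.drop_length]; omega⟩
    have getVert_eq := hG.eq_snd_of_adj_start (hp.drop i) h getVert_mem
    rw [Walk.snd, Walk.drop_getVert] at getVert_eq
    have : i ≠ j := fun e => h.ne (congrArg p.getVert e)
    exact (hp.getVert_injOn hj (show i + 1 ≤ p.length by omega) getVert_eq).symm
  · obtain rfl : i + 1 = j := by omega
    exact p.adj_getVert_succ (by omega)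

theorem exists_iso_pathGraph [Finite V] (hG : IsLinearForest G) (hconn : G.Connected) :
    ∃ n, Nonempty (G ≃g pathGraph n) := by
  obtain ⟨u, v, p, hp, hsupp⟩ := exists_isPath_support_eq_univ hG hconn
  have bijective : Function.Bijective fun i : Fin (p.length + 1) => p.getVert i := by
    refine ⟨fun i j h => Fin.ext ?_, fun x => ?_⟩
    · exact hp.getVert_injOn (Nat.le_of_lt_succ i.2) (Nat.le_of_lt_succ j.2) h
    obtain ⟨i, hi, hle⟩ := Walk.mem_support_iff_exists_getVert.1 (hsupp x)
    exact ⟨⟨i, Nat.lt_succ_of_le hle⟩, hi⟩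
  refine ⟨p.length + 1, ⟨(RelIso.mk (Equiv.ofBijective _ bijective) fun {i j} => ?_).symm⟩⟩
  rw [pathGraph_adj]
  exact getVert_adj_getVert_iff hG.1 hp (Nat.le_of_lt_succ i.2) (Nat.le_of_lt_succ j.2)

theorem IsLinearForest.isDisjointUnionOfPaths [Finite V] (hG : IsLinearForest G) :
    G.IsDisjointUnionOfPaths := fun c =>
  exists_iso_pathGraph (hG.comap c.toSimpleGraph_hom Subtype.val_injective)
    c.connected_toSimpleGraph

theorem exists_position (hG : G.IsDisjointUnionOfPaths) :
    ∃ pos : V → ℕ, (∀ a b, G.Adj a b → pos a + 1 = pos b ∨ pos b + 1 = pos a) ∧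
      ∀ a b, G.Reachable a b → pos a = pos b → a = b := by
  choose n φ using hG
  let pos (a : V) : ℕ := ((φ (G.connectedComponentMk a)).some ⟨a, rfl⟩).val
  have pos_eq {c} {a} (ha : a ∈ ConnectedComponent.supp c) :
      pos a = ((φ c).some ⟨a, ha⟩).val := by
    obtain rfl : G.connectedComponentMk a = c := ha
    rfl
  refine ⟨pos, fun a b hab => ?_, fun a b hab h => ?_⟩
  · have hb : b ∈ (G.connectedComponentMk a).supp := ConnectedComponent.sound hab.symm.reachable
    rw [pos_eq rfl, pos_eq hb]
    exact pathGraph_adj.1 ((φ _).some.map_adj_iff.2 hab)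
  · have hb : b ∈ (G.connectedComponentMk a).supp := ConnectedComponent.sound hab.symm
    rw [pos_eq rfl, pos_eq hb] at h
    exact congrArg Subtype.val ((φ _).some.injective (Fin.ext h))

end LinearForest

/-! ### Layerings and their torsos -/

section Layering

variable {V : Type*} {G : SimpleGraph V} {l : V → ℕ}

/-- A partition of the vertices into breadth-first layers from one root in every component: `l a`
is the index of the layer of `a`. -/
structure IsLayering (G : SimpleGraph V) (l : V → ℕ) : Prop where
  le_of_adj : ∀ a b, G.Adj a b → l a ≤ l b + 1
  exists_adj : ∀ a, l a ≠ 0 → ∃ b, G.Adj b a ∧ l b + 1 = l a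
  eq_of_reachable : ∀ a b, G.Reachable a b → l a = 0 → l b = 0 → a = b

/-- The vertices of the component of `u` in the layers above the layer of `u`. -/
def upperSide (G : SimpleGraph V) (l : V → ℕ) (u : V) : Set V :=
  {x | G.Reachable x u ∧ l x < l u}

/-- The union of the components of the part of `G` below the layer of `u` to which `u` is
attached. -/
def lowerSide (G : SimpleGraph V) (l : V → ℕ) (u : V) : Set V :=
  {x | ∃ y, G.Adj u y ∧ l u < l y ∧ (within G {z | l u < l z}).Reachable y x}

/-- The torso of a layer: two vertices of the layer are adjacent if they are adjacent in `G` or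
attached to the same component of the lower layers. This is the disjoint union of the torsos of
all layers. -/
def layerTorso (G : SimpleGraph V) (l : V → ℕ) : SimpleGraph V where
  Adj a b := a ≠ b ∧ l a = l b ∧ (G.Adj a b ∨ (lowerSide G l a ∩ lowerSide G l b).Nonempty)
  symm := ⟨fun _ b h =>
    ⟨h.1.symm, h.2.1.symm, h.2.2.imp Adj.symm fun h => Set.inter_comm _ (lowerSide G l b) ▸ h⟩⟩
  loopless := ⟨fun _ h => h.1 rfl⟩

theorem lt_of_mem_lowerSide {u x : V} (h : x ∈ lowerSide G l u) : l u < l x := by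
  obtain ⟨y, -, hy, hyx⟩ := h
  exact mem_of_reachable_within (A := {z | l u < l z}) hyx hy

theorem reachable_of_mem_lowerSide {u x : V} (h : x ∈ lowerSide G l u) : G.Reachable x u := by
  obtain ⟨y, huy, -, hyx⟩ := h
  exact (huy.reachable.trans (hyx.mono within_le)).symm

theorem mem_lowerSide_of_reachable {u x y : V} (hx : x ∈ lowerSide G l u)
    (hxy : (within G {z | l u < l z}).Reachable x y) : y ∈ lowerSide G l u := by
  obtain ⟨z, huz, hz, hzx⟩ := hx
  exact ⟨z, huz, hz, hzx.trans hxy⟩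

theorem reachable_of_layerTorso_adj {a b : V} (h : (layerTorso G l).Adj a b) :
    G.Reachable b a := by
  obtain ⟨-, -, h | ⟨z, hza, hzb⟩⟩ := h
  · exact h.symm.reachable
  · exact (reachable_of_mem_lowerSide hzb).symm.trans (reachable_of_mem_lowerSide hza)

theorem eq_and_reachable_of_layerTorso_reachable {a b : V}
    (h : (layerTorso G l).Reachable a b) : l b = l a ∧ G.Reachable b a :=
  prop_of_reachable (P := fun z => l z = l a ∧ G.Reachable z a)
    (fun x y (hxy : (layerTorso G l).Adj x y) hx =>
      ⟨hxy.2.1.symm.trans hx.1, (reachable_of_layerTorso_adj hxy).trans hx.2⟩)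
    h ⟨rfl, Reachable.refl a⟩

theorem IsLayering.exists_root (hl : IsLayering G l) (w : V) :
    ∃ r, l r = 0 ∧ (within G {x | l x ≤ l w}).Reachable w r := by
  induction hn : l w generalizing w with
  | zero => exact ⟨w, hn, Reachable.refl w⟩
  | succ n ih =>
    obtain ⟨b, hbw, hb⟩ := hl.exists_adj w (by omega)
    obtain ⟨r, hr, hbr⟩ := ih b (by omega)
    have hwb : (within G {x | l x ≤ n + 1}).Adj w b := within_adj.2
      ⟨hbw.symm, hn.le, show l b ≤ n + 1 by omega⟩
    exact ⟨r, hr, hwb.reachable.trans (hbr.mono (within_mono fun x hx => Nat.le_succ_of_le hx))⟩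

theorem IsLayering.connected_upperSide (hl : IsLayering G l) {u : V} (hu : l u ≠ 0) :
    (G.induce (upperSide G l u)).Connected := by
  have exists_root (x) (hx : x ∈ upperSide G l u) :
      ∃ r, l r = 0 ∧ G.Reachable x r ∧ (within G (upperSide G l u)).Reachable x r := by
    obtain ⟨r, hr, hxr⟩ := hl.exists_root x
    refine ⟨r, hr, hxr.mono within_le, (reachable_within_class hxr).mono (within_mono ?_)⟩
    exact fun y hxy => ⟨(hxy.mono within_le).symm.trans hx.1,
      (mem_of_reachable_within hxy (le_refl (l x))).trans_lt hx.2⟩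
  refine connected_induce_iff_within.2 ⟨?_, fun x hx y hy => ?_⟩
  · obtain ⟨b, hbu, hb⟩ := hl.exists_adj u hu
    exact ⟨b, hbu.reachable, by omega⟩
  · obtain ⟨r, hr, hxr, hxr'⟩ := exists_root x hx
    obtain ⟨s, hs, hys, hys'⟩ := exists_root y hy
    obtain rfl := hl.eq_of_reachable r s
      (hxr.symm.trans ((hx.1.trans hy.1.symm).trans hys)) hr hs
    exact hxr'.trans hys'.symm

theorem IsLayering.exists_adj_upperSide (hl : IsLayering G l) {u w : V} (hu : l u ≠ 0)
    (hw : l w = l u) (hwu : G.Reachable w u) : ∃ a ∈ upperSide G l u, G.Adj a w := by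
  obtain ⟨b, hbw, hb⟩ := hl.exists_adj w (hw.trans_ne hu)
  exact ⟨b, ⟨hbw.reachable.trans hwu, by omega⟩, hbw⟩

/-- Three such vertices, the part of `G` above them and the component of `z` below them would form
a `K₂,₃` minor. -/
theorem IsLayering.not_mem_three_lowerSides (hl : IsLayering G l)
    (hG : ¬IsMinor (completeBipartiteGraph (Fin 2) (Fin 3)) G) {z : V} {w : Fin 3 → V}
    (hw : Function.Injective w) (hlw : ∀ i, l (w i) = l (w 0)) :
    ¬∀ i, z ∈ lowerSide G l (w i) := fun hz => by
  have hreach (i) : G.Reachable (w i) (w 0) :=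
    (reachable_of_mem_lowerSide (hz i)).symm.trans (reachable_of_mem_lowerSide (hz 0))
  have hw₀ : l (w 0) ≠ 0 := fun h =>
    hw.ne (by decide : (1 : Fin 3) ≠ 0) (hl.eq_of_reachable _ _ (hreach 1) ((hlw 1).trans h) h)
  let K : Set V := {x | (within G {x | l (w 0) < l x}).Reachable z x}
  have lt_of_mem_K {x} (hx : x ∈ K) : l (w 0) < l x :=
    mem_of_reachable_within (A := {x | l (w 0) < l x}) hx (lt_of_mem_lowerSide (hz 0))
  have adj_K (i) : ∃ y ∈ K, G.Adj y (w i) := by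
    obtain ⟨y, hy, -, hyz⟩ := hz i
    exact ⟨y, (hlw i ▸ hyz).symm, hy.symm⟩
  have adj_side (j : Fin 2) (i) : ∃ y ∈ ![upperSide G l (w 0), K] j, G.Adj y (w i) := by
    fin_cases j
    exacts [hl.exists_adj_upperSide hw₀ (hlw i) (hreach i), adj_K i]
  have side_ne {j : Fin 2} {x i} (hx : x ∈ ![upperSide G l (w 0), K] j) : x ≠ w i := by
    rintro rfl
    fin_cases j
    exacts [hx.2.ne (hlw i), (lt_of_mem_K hx).ne' (hlw i)]
  have disjoint_sides : Disjoint (upperSide G l (w 0)) K :=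
    Set.disjoint_left.2 fun x hx hxK => hx.2.not_gt (lt_of_mem_K hxK)
  refine hG ⟨Sum.elim ![upperSide G l (w 0), K] fun i => {w i}, ?_, ?_, ?_⟩
  · rintro (j | i)
    · fin_cases j
      exacts [hl.connected_upperSide hw₀, connected_induce_of_reachable (Reachable.refl z)
        fun y hy => reachable_within_class hy]
    · exact .of_subsingleton (G := G.induce {w i})
  · rintro (j | i) (j' | i') h
    · fin_cases j <;> fin_cases j'
      exacts [(h rfl).elim, disjoint_sides, disjoint_sides.symm, (h rfl).elim]
    · exact Set.disjoint_singleton_right.2 fun h => side_ne h rfl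
    · exact Set.disjoint_singleton_left.2 fun h => side_ne h rfl
    · exact Set.disjoint_singleton.2 (hw.ne (ne_of_apply_ne _ h))
  · rintro (j | i) (j' | i') h
    · simp at h
    · exact (adj_side j i').imp fun y hy => ⟨hy.1, _, rfl, hy.2⟩
    · obtain ⟨y, hy, hyw⟩ := adj_side j' i
      exact ⟨_, rfl, y, hy, hyw.symm⟩
    · simp at h

section OwnSide

variable [LinearOrder V]

/-- The part of `lowerSide G l a` which is assigned to `a` when every component of the lower layers
is assigned to the least of the vertices to which it is attached. -/
def ownSide (G : SimpleGraph V) (l : V → ℕ) (a : V) : Set V :=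
  {z ∈ lowerSide G l a | ∀ b, l b = l a → z ∈ lowerSide G l b → a ≤ b}

theorem reachable_within_ownSide {a x y : V} (hx : x ∈ ownSide G l a)
    (hxy : (within G {z | l a < l z}).Reachable x y) :
    (within G (ownSide G l a)).Reachable x y := by
  refine (reachable_within_class hxy).mono (within_mono fun z hxz => ?_)
  refine ⟨mem_lowerSide_of_reachable hx.1 hxz, fun b hb hz => hx.2 b hb ?_⟩
  exact mem_lowerSide_of_reachable hz (hb ▸ hxz.symm)

theorem exists_adj_of_mem_ownSide {a b x : V} (hb : l b = l a) (hx : x ∈ ownSide G l a)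
    (hxb : x ∈ lowerSide G l b) :
    ∃ y, G.Adj b y ∧ y ∈ ownSide G l a ∧ (within G (ownSide G l a)).Reachable y x := by
  obtain ⟨y, hby, -, hyx⟩ := hxb
  have hxy := reachable_within_ownSide hx (hb ▸ hyx.symm)
  exact ⟨y, hby, mem_of_reachable_within hxy hx, hxy.symm⟩

theorem connected_insert_ownSide (a : V) : (G.induce (insert a (ownSide G l a))).Connected := by
  refine connected_induce_of_reachable (Set.mem_insert _ _) fun x hx => ?_
  obtain rfl | hx := hx
  · exact Reachable.refl x
  · obtain ⟨y, hay, hy, hyx⟩ := exists_adj_of_mem_ownSide rfl hx hx.1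
    exact (within_adj.2 ⟨hay, Set.mem_insert _ _, Set.mem_insert_of_mem _ hy⟩).reachable.trans
      (hyx.mono (within_mono (Set.subset_insert _ _)))

theorem disjoint_insert_ownSide {a b : V} (hab : a ≠ b) (hl : l a = l b) :
    Disjoint (insert a (ownSide G l a)) (insert b (ownSide G l b)) := by
  rw [Set.disjoint_left]
  rintro x (rfl | hxa) (rfl | hxb)
  · exact hab rfl
  · exact (lt_of_mem_lowerSide hxb.1).ne' hl
  · exact (lt_of_mem_lowerSide hxa.1).ne hl
  · exact hab (le_antisymm (hxa.2 b hl.symm hxb.1) (hxb.2 a hl hxa.1))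

theorem IsLayering.exists_adj_insert_ownSide (hl : IsLayering G l)
    (hG : ¬IsMinor (completeBipartiteGraph (Fin 2) (Fin 3)) G) {a b : V}
    (hab : (layerTorso G l).Adj a b) :
    ∃ x ∈ insert a (ownSide G l a), ∃ y ∈ insert b (ownSide G l b), G.Adj x y := by
  wlog hle : a ≤ b generalizing a b
  · obtain ⟨x, hx, y, hy, hxy⟩ := this hab.symm (le_of_not_ge hle)
    exact ⟨y, hy, x, hx, hxy.symm⟩
  obtain ⟨hne, hlab, hadj | ⟨z, hza, hzb⟩⟩ := hab
  · exact ⟨a, Set.mem_insert _ _, b, Set.mem_insert _ _, hadj⟩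
  · have hz : z ∈ ownSide G l a := by
      refine ⟨hza, fun c hc hzc => ?_⟩
      by_contra! hca
      refine hl.not_mem_three_lowerSides hG (z := z) (w := ![a, b, c]) ?_ ?_ ?_
      · have := hca.trans_le hle
        intro i j hij
        fin_cases i <;> fin_cases j <;> simp_all
      · simp [Fin.forall_fin_succ, *]
      · simp [Fin.forall_fin_succ, *]
    obtain ⟨y, hby, hy, -⟩ := exists_adj_of_mem_ownSide hlab.symm hz hzb
    exact ⟨y, Set.mem_insert_of_mem _ hy, b, Set.mem_insert _ _, hby.symm⟩

theorem IsLayering.isMinor_cone_induce_layerTorso (hl : IsLayering G l)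
    (hG : ¬IsMinor (completeBipartiteGraph (Fin 2) (Fin 3)) G) {u : V} (hu : l u ≠ 0) {A : Set V}
    (hA : ∀ a ∈ A, l a = l u ∧ G.Reachable a u) :
    IsMinor (cone ((layerTorso G l).induce A)) G := by
  have adj_upper (a : A) :
      ∃ x ∈ upperSide G l u, ∃ y ∈ insert ↑a (ownSide G l a), G.Adj x y := by
    obtain ⟨x, hx, hxa⟩ := hl.exists_adj_upperSide hu (hA a a.2).1 (hA a a.2).2
    exact ⟨x, hx, a, Set.mem_insert _ _, hxa⟩
  have disjoint_upper (a : A) :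
      Disjoint (upperSide G l u) (insert ↑a (ownSide G l a)) := by
    refine Set.disjoint_left.2 fun x hx hxa => hx.2.not_ge ?_
    rw [← (hA a a.2).1]
    exact hxa.elim (fun h => h ▸ le_rfl) fun h => (lt_of_mem_lowerSide h.1).le
  refine ⟨fun i => i.elim (upperSide G l u) fun a => insert ↑a (ownSide G l a), ?_, ?_, ?_⟩
  · rintro (_ | a)
    exacts [hl.connected_upperSide hu, connected_insert_ownSide _]
  · rintro (_ | a) (_ | b) h
    · exact (h rfl).elim
    · exact disjoint_upper b
    · exact (disjoint_upper a).symm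
    · exact disjoint_insert_ownSide (fun e => h (congrArg some (Subtype.ext e)))
        ((hA a a.2).1.trans (hA b b.2).1.symm)
  · rintro (_ | a) (_ | b) h
    · exact (not_cone_adj_none_none h).elim
    · exact adj_upper b
    · obtain ⟨x, hx, y, hy, hxy⟩ := adj_upper a
      exact ⟨y, hy, x, hx, hxy.symm⟩
    · exact hl.exists_adj_insert_ownSide hG h

end OwnSide

theorem isLinearForest_of_forall_induce_supp
    (h : ∀ c : G.ConnectedComponent, IsLinearForest (G.induce c.supp)) : IsLinearForest G := by
  refine ⟨fun v p hp => ?_, fun v a b c ha hb hc => ?_⟩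
  · have mem_supp (w) (hw : w ∈ p.support) : w ∈ (G.connectedComponentMk v).supp := by
      obtain ⟨q, -⟩ := Walk.mem_support_iff_exists_append.1 hw
      exact ConnectedComponent.sound q.reachable.symm
    exact (h _).1 (p.induce _ mem_supp) (.of_map (by rwa [Walk.map_induce]))
  · have mem_supp {w} (hw : G.Adj v w) : w ∈ (G.connectedComponentMk v).supp :=
      ConnectedComponent.sound hw.reachable.symm
    simpa only [Subtype.mk.injEq] using (h (G.connectedComponentMk v)).2 ⟨v, rfl⟩
      ⟨a, mem_supp ha⟩ ⟨b, mem_supp hb⟩ ⟨c, mem_supp hc⟩ ha hb hc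

/-- Contracting the layers above a component of the torso to an apex and the components of the
layers below into the layer turns `G` into the cone over that component. -/
theorem IsLayering.isLinearForest_layerTorso (hl : IsLayering G l)
    (hK₄ : ¬IsMinor (⊤ : SimpleGraph (Fin 4)) G)
    (hK₂₃ : ¬IsMinor (completeBipartiteGraph (Fin 2) (Fin 3)) G) :
    IsLinearForest (layerTorso G l) := by
  refine isLinearForest_of_forall_induce_supp fun c => ?_
  induction c using ConnectedComponent.ind with | _ u
  have mem_component (a) (ha : a ∈ ((layerTorso G l).connectedComponentMk u).supp) :
      l a = l u ∧ G.Reachable a u :=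
    eq_and_reachable_of_layerTorso_reachable (ConnectedComponent.exact ha).symm
  by_cases hu : l u = 0
  · have subsingleton : Subsingleton ((layerTorso G l).connectedComponentMk u).supp := by
      refine ⟨fun a b => Subtype.ext ?_⟩
      obtain ⟨ha, hau⟩ := mem_component a a.2
      obtain ⟨hb, hbu⟩ := mem_component b b.2
      exact hl.eq_of_reachable _ _ (hau.trans hbu.symm) (ha.trans hu) (hb.trans hu)
    exact ⟨IsAcyclic.of_subsingleton, fun _ a b _ _ _ _ => .inl (subsingleton.elim a b)⟩
  · let : LinearOrder V := IsWellOrder.linearOrder WellOrderingRel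
    have cone_minor := hl.isMinor_cone_induce_layerTorso hK₂₃ hu mem_component
    exact isLinearForest_of_not_isMinor_cone (fun h => hK₄ (h.trans cone_minor))
      fun h => hK₂₃ (h.trans cone_minor)

theorem isLayering_dist (root : G.ConnectedComponent → V)
    (hroot : ∀ c, G.connectedComponentMk (root c) = c) :
    IsLayering G fun a => G.dist (root (G.connectedComponentMk a)) a where
  le_of_adj a b hab := by
    rw [ConnectedComponent.sound hab.reachable]
    rcases hab.diff_dist_adj (u := root (G.connectedComponentMk b)) with h | h | h <;> omega
  exists_adj a ha := by
    have hra : G.Reachable (root (G.connectedComponentMk a)) a :=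
      ConnectedComponent.exact (hroot _)
    obtain ⟨p, hp⟩ := hra.exists_walk_length_eq_dist
    have hpa : G.Adj p.penultimate a := p.adj_penultimate fun h =>
      ha (hp.symm.trans (Walk.length_eq_zero_iff.2 h))
    refine ⟨p.penultimate, hpa, ?_⟩
    have dist_penultimate := dist_le p.dropLast
    rw [p.length_dropLast] at dist_penultimate
    rw [ConnectedComponent.sound hpa.reachable]
    rcases hpa.diff_dist_adj (u := root (G.connectedComponentMk a)) with h | h | h <;> omega
  eq_of_reachable a b hab ha hb := by
    have root_eq (x) (hx : G.dist (root (G.connectedComponentMk x)) x = 0) :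
        root (G.connectedComponentMk x) = x :=
      ((ConnectedComponent.exact (hroot _)).dist_eq_zero_iff).1 hx
    rw [← root_eq a ha, ← root_eq b hb, ConnectedComponent.sound hab]

theorem exists_isLayering (G : SimpleGraph V) : ∃ l, IsLayering G l :=
  ⟨_, isLayering_dist (fun c => c.out) Quot.out_eq⟩

theorem exists_isLayering_bfsLayer (G : SimpleGraph V) (v : V) :
    ∃ l, IsLayering G l ∧ ∀ j, ∀ w ∈ G.bfsLayer v j, l w = j := by
  classical
  refine ⟨_, isLayering_dist (Function.update (fun c => c.out) (G.connectedComponentMk v) v)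
    fun c => ?_, fun j w hw => ?_⟩
  · obtain rfl | hc := eq_or_ne c (G.connectedComponentMk v)
    · rw [Function.update_self]
    · rw [Function.update_of_ne hc]
      exact Quot.out_eq c
  · have hw : G.edist v w = j := hw
    have hvw : G.Reachable v w := edist_ne_top_iff_reachable.1 (hw ▸ ENat.natCast_ne_top j)
    rw [← ConnectedComponent.sound hvw, Function.update_self, SimpleGraph.dist, hw,
      ENat.toNat_natCast]

theorem isDisjointUnionOfPaths_induce_bfsLayer [Finite V]
    (hK₄ : ¬IsMinor (⊤ : SimpleGraph (Fin 4)) G)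
    (hK₂₃ : ¬IsMinor (completeBipartiteGraph (Fin 2) (Fin 3)) G) (v : V) (j : ℕ) :
    (G.induce (G.bfsLayer v j)).IsDisjointUnionOfPaths := by
  obtain ⟨l, hl, hlv⟩ := exists_isLayering_bfsLayer G v
  let toTorso : G.induce (G.bfsLayer v j) →g layerTorso G l :=
    ⟨Subtype.val, fun {a b} hab =>
      ⟨G.ne_of_adj hab, (hlv j a a.2).trans (hlv j b b.2).symm, .inl hab⟩⟩
  exact ((hl.isLinearForest_layerTorso hK₄ hK₂₃).comap toTorso
    Subtype.val_injective).isDisjointUnionOfPaths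

end Layering

/-! ### Vertex rankings -/

section Ranking

variable {V : Type*} {G : SimpleGraph V} {A : Set V} {ρ : V → ℕ}

/-- `ρ` is a vertex ranking of `G[A]`: every path of `G[A]` between two different vertices of the
same rank contains a vertex of smaller rank. Vertices closer to the roots of the corresponding
elimination forest get smaller ranks. -/
def IsVertexRanking (G : SimpleGraph V) (A : Set V) (ρ : V → ℕ) : Prop :=
  ∀ x ∈ A, ∀ y, ρ x = ρ y → (within G (A ∩ {z | ρ x ≤ ρ z})).Reachable x y → x = y

theorem mem_and_le_of_reachable {x y : V}
    (h : (within G (A ∩ {z | ρ x ≤ ρ z})).Reachable x y) (hx : x ∈ A) : y ∈ A ∧ ρ x ≤ ρ y :=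
  mem_of_reachable_within (A := A ∩ {z | ρ x ≤ ρ z}) h ⟨hx, le_refl (ρ x)⟩

theorem IsVertexRanking.hasEliminationForest {d : ℕ} (hρ : IsVertexRanking G A ρ)
    (hd : ∀ x ∈ A, ρ x < d) : (G.induce A).HasEliminationForest d := by
  let anc (x y : A) : Prop := (within G (A ∩ {z | ρ x ≤ ρ z})).Reachable (x : V) y
  have rank_le {x y : A} (h : anc x y) : ρ x ≤ ρ y :=
    (mem_and_le_of_reachable h x.2).2
  have reachable_of_le {x y z : A} (hxy : ρ x ≤ ρ y) (h : anc y z) :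
      (within G (A ∩ {z | ρ x ≤ ρ z})).Reachable (y : V) z :=
    h.mono (within_mono fun _ hw => ⟨hw.1, hxy.trans hw.2⟩)
  have anc_of_adj {x y : A} (hxy : G.Adj x y) (h : ρ x ≤ ρ y) : anc x y :=
    Adj.reachable (within_adj.2 ⟨hxy, ⟨x.2, le_refl (ρ x)⟩, y.2, h⟩)
  have rank_injOn (z : A) : Set.InjOn (fun x : A => ρ x) {x | anc x z} := fun x hx y hy hxy =>
    Subtype.ext (hρ x x.2 y hxy (Reachable.trans hx (reachable_of_le hxy.le hy).symm))
  have rank_mapsTo (z : A) : Set.MapsTo (fun x : A => ρ x) {x | anc x z} (Set.Iio d) :=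
    fun x _ => hd x x.2
  refine ⟨anc, fun x => Reachable.refl _, fun x y hxy hyx => ?_, fun x y z hxy hyz => ?_,
    fun x y z hxz hyz => ?_, fun x y hxy => ?_, fun z => ⟨?_, ?_⟩⟩
  · exact Subtype.ext (hρ x x.2 y (le_antisymm (rank_le hxy) (rank_le hyx)) hxy)
  · exact Reachable.trans hxy (reachable_of_le (rank_le hxy) hyz)
  · rcases le_total (ρ x) (ρ y) with h | h
    · exact .inl (Reachable.trans hxz (reachable_of_le h hyz).symm)
    · exact .inr (Reachable.trans hyz (reachable_of_le h hxz).symm)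
  · rcases le_total (ρ x) (ρ y) with h | h
    · exact .inl (anc_of_adj hxy h)
    · exact .inr (anc_of_adj hxy.symm h)
  · exact Set.Finite.of_injOn (rank_mapsTo z) (rank_injOn z) (Set.finite_Iio d)
  · calc {x | anc x z}.ncard ≤ (Set.Iio d).ncard :=
          Set.ncard_le_ncard_of_injOn _ (rank_mapsTo z) (rank_injOn z)
      _ = d := by simp

theorem exists_reachable_apply_eq {f : V → ℕ} (hf : ∀ a b, G.Adj a b → f b ≤ f a + 1) {x y : V}
    (h : G.Reachable x y) {c : ℕ} (hxc : f x ≤ c) (hcy : c ≤ f y) :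
    ∃ z, G.Reachable x z ∧ f z = c := by
  have key : G.Reachable x y ∧ ((∃ z, G.Reachable x z ∧ f z = c) ∨ f y < c) := by
    refine prop_of_reachable
      (P := fun w => G.Reachable x w ∧ ((∃ z, G.Reachable x z ∧ f z = c) ∨ f w < c))
      (fun a b hab ⟨ha, hac⟩ => ⟨ha.trans hab.reachable, hac.elim .inl fun hac => ?_⟩) h
      ⟨Reachable.refl x, ?_⟩
    · rcases (Nat.lt_or_eq_of_le ((hf a b hab).trans hac)) with hbc | hbc
      · exact .inr hbc
      · exact .inl ⟨b, ha.trans hab.reachable, hbc⟩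
    · rcases hxc.lt_or_eq with hxc | hxc
      · exact .inr hxc
      · exact .inl ⟨x, Reachable.refl x, hxc⟩
  exact key.2.resolve_right hcy.not_gt

theorem exists_between_padicValNat_two_lt {a b : ℕ} (ha : a ≠ 0) (hab : a < b)
    (h : padicValNat 2 a = padicValNat 2 b) :
    ∃ c, a ≤ c ∧ c ≤ b ∧ padicValNat 2 a < padicValNat 2 c := by
  obtain ⟨s, hs⟩ : 2 ^ padicValNat 2 a ∣ a := pow_padicValNat_dvd
  obtain ⟨t, ht⟩ : 2 ^ padicValNat 2 a ∣ b := by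
    rw [h]
    exact pow_padicValNat_dvd
  have hnot := pow_succ_padicValNat_not_dvd (p := 2) ha
  generalize padicValNat 2 a = k at hs ht hnot ⊢
  have s_odd : ¬2 ∣ s := fun hs₂ => hnot (by rw [hs, pow_succ]; exact Nat.mul_dvd_mul_left _ hs₂)
  have s_lt_t : s < t := by
    rw [hs, ht] at hab
    exact lt_of_mul_lt_mul_left hab (Nat.zero_le _)
  refine ⟨2 ^ k * (s + 1), ?_, ?_, ?_⟩
  · exact hs.trans_le (Nat.mul_le_mul_left _ s.le_succ)
  · exact (Nat.mul_le_mul_left _ s_lt_t).trans_eq ht.symm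
  · rw [← Nat.succ_le_iff, ← padicValNat_dvd_iff_le (by positivity), Nat.succ_eq_add_one, pow_succ]
    exact Nat.mul_dvd_mul_left _ (by omega)

/-- The optimal ranking of a path: between two positions with the same power of two there is one
with a higher power of two. -/
theorem isVertexRanking_sub_padicValNat {f : V → ℕ} {q : ℕ}
    (hf : ∀ a b, (within G A).Adj a b → f b ≤ f a + 1)
    (hinj : ∀ a b, (within G A).Reachable a b → f a = f b → a = b)
    (hA : ∀ a ∈ A, f a ≠ 0 ∧ f a < 2 ^ q) :
    IsVertexRanking G A fun a => q - 1 - padicValNat 2 (f a) := by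
  generalize hρ : (fun a => q - 1 - padicValNat 2 (f a)) = ρ
  have rank_eq (a) : ρ a = q - 1 - padicValNat 2 (f a) := (congrFun hρ a).symm
  intro x hx y hxy h
  wlog hle : f x ≤ f y generalizing x y
  · have hy := (mem_and_le_of_reachable h hx).1
    exact (this y hy x hxy.symm (by simpa only [hxy] using h.symm) (le_of_not_ge hle)).symm
  have padicValNat_lt {a} (ha : a ∈ A) : padicValNat 2 (f a) < q :=
    (padicValNat_le_nat_log _).trans_lt (Nat.log_lt_of_lt_pow (hA a ha).1 (hA a ha).2)
  have hy := (mem_and_le_of_reachable h hx).1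
  have hval : padicValNat 2 (f x) = padicValNat 2 (f y) := by
    have := padicValNat_lt hx
    have := padicValNat_lt hy
    rw [rank_eq, rank_eq] at hxy
    omega
  refine hinj x y (h.mono (within_mono Set.inter_subset_left)) ?_
  by_contra hne
  obtain ⟨c, hxc, hcy, hc⟩ :=
    exists_between_padicValNat_two_lt (hA x hx).1 (lt_of_le_of_ne hle hne) hval
  obtain ⟨z, hz, rfl⟩ := exists_reachable_apply_eq
    (fun a b hab => hf a b (within_mono Set.inter_subset_left hab)) h hxc hcy
  obtain ⟨hzA, hxz⟩ := mem_and_le_of_reachable hz hx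
  have := padicValNat_lt hzA
  rw [rank_eq, rank_eq] at hxz
  omega

theorem div_eq_and_mod_le_of_not_dvd {m a b : ℕ} (hab : a ≤ b + 1) (hba : b ≤ a + 1)
    (ha : ¬m ∣ a) (hb : ¬m ∣ b) : a / m = b / m ∧ b % m ≤ a % m + 1 := by
  have hdiv : a / m = b / m := by
    obtain rfl | rfl | rfl : a = b ∨ a = b + 1 ∨ b = a + 1 := by omega
    · rfl
    · rw [Nat.succ_div, if_neg ha, add_zero]
    · rw [Nat.succ_div, if_neg hb, add_zero]
  have := Nat.div_add_mod a m
  have := Nat.div_add_mod b m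
  refine ⟨hdiv, ?_⟩
  rw [hdiv] at *
  omega

theorem div_eq_div_of_reachable {f : V → ℕ} (hf : ∀ a b, G.Adj a b → f a ≤ f b + 1) {m : ℕ}
    {x y : V} (h : (within G {z | ¬m ∣ f z}).Reachable x y) : f x / m = f y / m := by
  refine prop_of_reachable (P := fun z => f x / m = f z / m) (fun a b hab ha => ?_) h rfl
  obtain ⟨hab, ha', hb⟩ := within_adj.1 hab
  exact ha.trans (div_eq_and_mod_le_of_not_dvd (hf a b hab) (hf b a hab.symm) ha' hb).1

end Ranking

/-! ### Sparse sets of vertices -/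

section SparseSet

variable {V : Type*} {G : SimpleGraph V} {f l : V → ℕ} {m s q : ℕ}

/-- The vertices at which `f` takes a value in one residue class modulo `m`, namely that of
`-s`. -/
def sparseSet (f : V → ℕ) (m s : ℕ) : Set V :=
  {v | m ∣ f v + s}

theorem ncard_setOf_mem_sparseSet_le (f : V → ℕ) (m : ℕ) (v : V) :
    {s : Fin m | v ∈ sparseSet f m s}.ncard ≤ 1 := by
  refine (Set.ncard_le_one).2 fun a ha b hb => Fin.ext ?_
  have hmod : f v + a ≡ f v + b [MOD m] :=
    (Nat.modEq_zero_iff_dvd.2 ha).trans (Nat.modEq_zero_iff_dvd.2 hb).symm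
  exact (Nat.ModEq.add_left_cancel' _ hmod).eq_of_lt_of_lt a.2 b.2

theorem isVertexRanking_compl_sparseSet (hm : 0 < m) (hq : m ≤ 2 ^ q)
    (hf : ∀ a b, G.Adj a b → f a ≤ f b + 1)
    (hinj : ∀ a b, G.Reachable a b → f a = f b → a = b) :
    IsVertexRanking G (sparseSet f m s)ᶜ fun a => q - 1 - padicValNat 2 ((f a + s) % m) := by
  have hf' (a b) (hab : G.Adj a b) : f a + s ≤ f b + s + 1 := by
    have := hf a b hab
    omega
  refine isVertexRanking_sub_padicValNat (fun a b hab => ?_) (fun a b hab hmod => ?_)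
    fun a ha => ⟨fun h => ha (Nat.dvd_of_mod_eq_zero h), (Nat.mod_lt _ hm).trans_le hq⟩
  · obtain ⟨hab, ha, hb⟩ := within_adj.1 hab
    exact (div_eq_and_mod_le_of_not_dvd (hf' a b hab) (hf' b a hab.symm) ha hb).2
  · have hdiv := div_eq_div_of_reachable hf' hab
    refine hinj a b (hab.mono within_le) (Nat.add_right_cancel (m := s) ?_)
    rw [← Nat.div_add_mod (f a + s) m, hdiv, hmod, Nat.div_add_mod]

theorem le_of_div_eq_of_mod_mul_add_le {a b r t : ℕ} (hdiv : a / m = b / m) (ht : t < q)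
    (h : a % m * q + r ≤ b % m * q + t) : a ≤ b := by
  have hmod : a % m ≤ b % m := by
    by_contra! hlt
    have := Nat.mul_le_mul_right q (Nat.succ_le_of_lt hlt)
    rw [Nat.succ_eq_add_one, add_mul, one_mul] at this
    omega
  rw [← Nat.div_add_mod a m, ← Nat.div_add_mod b m, hdiv]
  exact Nat.add_le_add_left hmod _

/-- A walk which stays in the layer of `x` and below casts a shadow in that layer, namely a walk of
the torso. -/
theorem exists_shadow {C : Set V} {x y : V} (hC : ∀ z ∈ C, l x ≤ l z) (hx : x ∈ C)
    (h : (within G C).Reachable x y) :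
    ∃ w, (within (layerTorso G l) (C ∩ {z | l z = l x})).Reachable x w ∧
      (y = w ∨ y ∈ lowerSide G l w) := by
  refine prop_of_reachable (P := fun z => ∃ w,
    (within (layerTorso G l) (C ∩ {z | l z = l x})).Reachable x w ∧
      (z = w ∨ z ∈ lowerSide G l w)) (fun y z hyz => ?_) h ⟨x, Reachable.refl x, .inl rfl⟩
  rintro ⟨w, hxw, hyw⟩
  obtain ⟨hwC, hw⟩ := mem_of_reachable_within hxw ⟨hx, by exact rfl⟩
  obtain ⟨hadj, -, hzC⟩ := within_adj.1 hyz
  have hw : l w = l x := hw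
  rcases (hC z hzC).lt_or_eq with hlz | hlz
  · refine ⟨w, hxw, .inr ?_⟩
    obtain rfl | hyw := hyw
    · exact ⟨z, hadj, hw ▸ hlz, Reachable.refl z⟩
    · exact mem_lowerSide_of_reachable hyw
        (Adj.reachable (within_adj.2 ⟨hadj, lt_of_mem_lowerSide hyw, show l w < l z from hw ▸ hlz⟩))
  · obtain rfl | hwz := eq_or_ne w z
    · exact ⟨w, hxw, .inl rfl⟩
    have torso_adj : (layerTorso G l).Adj w z := by
      refine ⟨hwz, hw.trans hlz, ?_⟩
      obtain rfl | hyw := hyw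
      · exact .inl hadj
      · have hzy : l z < l y := by
          rw [← hlz, ← hw]
          exact lt_of_mem_lowerSide hyw
        exact .inr ⟨y, hyw, y, hadj.symm, hzy, Reachable.refl y⟩
    exact ⟨z, hxw.trans (Adj.reachable (within_adj.2 ⟨torso_adj, ⟨hwC, hw⟩, hzC, hlz.symm⟩)),
      .inl rfl⟩

theorem IsVertexRanking.of_layerTorso {A : Set V} {ρ : V → ℕ}
    (hρ : IsVertexRanking (layerTorso G l) A ρ) (hq : ∀ a ∈ A, ρ a < q)
    (hl : ∀ a b, G.Adj a b → l a ≤ l b + 1) :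
    IsVertexRanking G (A ∩ (sparseSet l m s)ᶜ) fun a => (l a + s) % m * q + ρ a := by
  generalize hσ : (fun a => (l a + s) % m * q + ρ a) = σ
  have rank_eq (a) : σ a = (l a + s) % m * q + ρ a := (congrFun hσ a).symm
  intro x hx y hxy h
  have layer_le {z w} (hw : w ∈ A) (hdiv : (l z + s) / m = (l w + s) / m) (hzw : σ z ≤ σ w) :
      l z ≤ l w := by
    rw [rank_eq, rank_eq] at hzw
    exact Nat.le_of_add_le_add_right (le_of_div_eq_of_mod_mul_add_le hdiv (hq w hw) hzw)
  have block_eq {z} (hz : (within G (A ∩ (sparseSet l m s)ᶜ)).Reachable x z) :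
      (l x + s) / m = (l z + s) / m :=
    div_eq_div_of_reachable (f := fun z => l z + s) (fun a b hab => by
      have := hl a b hab
      omega) (hz.mono (within_mono fun _ hw => hw.2))
  have hxy' := h.mono (within_mono Set.inter_subset_left)
  obtain ⟨hy, -⟩ := mem_and_le_of_reachable h hx
  have hlxy : l y = l x := le_antisymm
    (layer_le hx.1 (block_eq hxy').symm hxy.ge) (layer_le hy.1 (block_eq hxy') hxy.le)
  let C : Set V := {z | z ∈ A ∧ l x ≤ l z ∧ (l z = l x → ρ x ≤ ρ z)}
  have shadow : (within G C).Reachable x y := by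
    refine (reachable_within_class h).mono (within_mono fun z hxz => ?_)
    obtain ⟨hz, hrank⟩ := mem_and_le_of_reachable hxz hx
    refine ⟨hz.1, layer_le hz.1 (block_eq (hxz.mono (within_mono Set.inter_subset_left)))
      hrank, fun hlz => ?_⟩
    simpa only [rank_eq, hlz, add_le_add_iff_left] using hrank
  have hxC : x ∈ C := ⟨hx.1, le_rfl, fun _ => le_rfl⟩
  obtain ⟨w, hxw, hyw⟩ := exists_shadow (l := l) (fun z hz => hz.2.1) hxC shadow
  obtain ⟨hw, hlw⟩ := mem_of_reachable_within hxw ⟨hxC, by exact rfl⟩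
  obtain rfl : y = w := hyw.resolve_right fun h =>
    (lt_of_mem_lowerSide h).ne (hlw.trans hlxy.symm)
  refine hρ x hx.1 y ?_ (hxw.mono (within_mono fun z hz => ⟨hz.1.1, hz.1.2.2 hz.2⟩))
  simpa only [rank_eq, hlxy, add_right_inj] using hxy

theorem treedepth_induce_compl_sparseSet_le {pos : V → ℕ} (hm : 0 < m) (hq : m ≤ 2 ^ q)
    (hq₀ : 0 < q) (hl : ∀ a b, G.Adj a b → l a ≤ l b + 1)
    (hpos : ∀ a b, (layerTorso G l).Adj a b → pos a ≤ pos b + 1)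
    (hinj : ∀ a b, (layerTorso G l).Reachable a b → pos a = pos b → a = b) :
    (G.induce (sparseSet pos m s ∪ sparseSet l m s)ᶜ).treedepth ≤ m * q := by
  rw [Set.compl_union]
  have torso_ranking := isVertexRanking_compl_sparseSet (s := s) hm hq hpos hinj
  have ranking := torso_ranking.of_layerTorso (m := m) (s := s) (q := q)
    (fun a _ => (Nat.sub_le _ _).trans_lt (Nat.sub_one_lt_of_lt hq₀)) hl
  refine Nat.sInf_le (ranking.hasEliminationForest fun x _ => ?_)
  have hlx : (l x + s) % m + 1 ≤ m := Nat.mod_lt _ hm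
  have := Nat.mul_le_mul_right q hlx
  rw [add_mul, one_mul] at this
  omega

end SparseSet

/-! ### Fractional fragility -/

section Fragility

variable {V : Type*} {G : SimpleGraph V}

theorem exists_pmf_of_ncard_mul_le {ι α : Type*} [Fintype ι] [Nonempty ι] (X : ι → Set α) (a : ℕ)
    (h : ∀ v, {i | v ∈ X i}.ncard * a ≤ Fintype.card ι) :
    ∃ P : PMF (Set α), (∀ S ∈ P.support, ∃ i, X i = S) ∧
      ∀ v, P.toOuterMeasure {S | v ∈ S} ≤ 1 / (a : ENNReal) := by
  classical
  refine ⟨(PMF.uniformOfFintype ι).map X, fun S hS => ?_, fun v => ?_⟩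
  · obtain ⟨i, -, hi⟩ := (PMF.mem_support_map_iff _ _ _).1 hS
    exact ⟨i, hi⟩
  · have hcard : Fintype.card (X ⁻¹' {S | v ∈ S}) = {i | v ∈ X i}.ncard :=
      (Nat.card_eq_fintype_card).symm
    rw [PMF.toOuterMeasure_map_apply, PMF.toOuterMeasure_uniformOfFintype_apply, hcard]
    have card_ne_zero : (Fintype.card ι : ENNReal) ≠ 0 := Nat.cast_ne_zero.2 Fintype.card_ne_zero
    refine ENNReal.div_le_of_le_mul ?_
    rw [one_div, mul_comm, ← div_eq_mul_inv,
      ENNReal.le_div_iff_mul_le (.inr card_ne_zero) (.inr (ENNReal.natCast_ne_top _))]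
    exact_mod_cast h v

theorem ceil_logb_two_natCast (a : ℕ) : (⌈Real.logb 2 (a : ℝ)⌉ : ℝ) = (Nat.clog 2 a : ℝ) := by
  have h := Real.ceil_logb_natCast (b := 2) (r := (a : ℝ)) (Nat.cast_nonneg a)
  rw [Int.clog_natCast, Nat.cast_ofNat] at h
  rw [h, Int.cast_natCast]

theorem monotone_two_mul_mul_one_add_ceil_logb :
    Monotone fun a : ℕ => 2 * (a : ℝ) * (1 + (⌈Real.logb 2 (a : ℝ)⌉ : ℝ)) := fun a b hab => by
  have hab' : (a : ℝ) ≤ b := Nat.cast_le.2 hab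
  have hclog : (Nat.clog 2 a : ℝ) ≤ Nat.clog 2 b := Nat.cast_le.2 (Nat.clog_mono_right 2 hab)
  simp only [ceil_logb_two_natCast]
  gcongr

/-- A vertex belongs to at most two of the `2a` sets obtained by deleting every `2a`-th layer and
every `2a`-th vertex of the torso paths, with a common offset. -/
theorem isFractionallyFragile_treedepth [Finite V]
    (hK₄ : ¬IsMinor (⊤ : SimpleGraph (Fin 4)) G)
    (hK₂₃ : ¬IsMinor (completeBipartiteGraph (Fin 2) (Fin 3)) G) :
    G.IsFractionallyFragile (fun _ G => (G.treedepth : ℝ))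
      (fun a => 2 * (a : ℝ) * (1 + (⌈Real.logb 2 (a : ℝ)⌉ : ℝ))) := by
  refine ⟨monotone_two_mul_mul_one_add_ceil_logb, fun a => ?_, fun a ha => ?_⟩
  · simp only [ceil_logb_two_natCast]
    positivity
  obtain ⟨l, hl⟩ := exists_isLayering G
  obtain ⟨pos, hpos, hinj⟩ :=
    exists_position (hl.isLinearForest_layerTorso hK₄ hK₂₃).isDisjointUnionOfPaths
  have : NeZero (2 * a) := ⟨by omega⟩
  let X (s : Fin (2 * a)) : Set V := sparseSet pos (2 * a) s ∪ sparseSet l (2 * a) s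
  have ncard_le_two (v) : {s | v ∈ X s}.ncard ≤ 2 :=
    (Set.ncard_union_le {s : Fin (2 * a) | v ∈ sparseSet pos (2 * a) s} _).trans
      (Nat.add_le_add (ncard_setOf_mem_sparseSet_le _ _ _) (ncard_setOf_mem_sparseSet_le _ _ _))
  obtain ⟨P, hPX, hP⟩ := exists_pmf_of_ncard_mul_le X a fun v => by
    rw [Fintype.card_fin]
    exact Nat.mul_le_mul_right a (ncard_le_two v)
  refine ⟨P, fun S hS => ?_, hP⟩
  obtain ⟨s, rfl⟩ := hPX S hS
  have two_mul_le : 2 * a ≤ 2 ^ (1 + Nat.clog 2 a) := by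
    rw [pow_add, pow_one]
    exact Nat.mul_le_mul_left 2 (Nat.le_pow_clog one_lt_two a)
  have treedepth_le := treedepth_induce_compl_sparseSet_le (s := s) (by omega) two_mul_le
    (by omega) hl.le_of_adj (fun a b hab => by have := hpos a b hab; omega) hinj
  simp only [ceil_logb_two_natCast]
  exact_mod_cast treedepth_le

end Fragility

end OuterplanarFragility

open OuterplanarFragility

theorem mainTheorem8_general :
    SimpleGraph.IsFractionallyFragileClass.{u}
      (fun _ G => ¬IsMinor (⊤ : SimpleGraph (Fin 4)) G ∧
        ¬IsMinor (completeBipartiteGraph (Fin 2) (Fin 3)) G)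
      (fun _ G => (G.treedepth : ℝ))
      (fun a => 2 * (a : ℝ) * (1 + (⌈Real.logb 2 (a : ℝ)⌉ : ℝ))) ∧
    ∀ (V : Type u) [Finite V] (G : SimpleGraph V), ¬IsMinor (⊤ : SimpleGraph (Fin 4)) G →
      ¬IsMinor (completeBipartiteGraph (Fin 2) (Fin 3)) G →
      ∀ (v : V) (j : ℕ), (G.induce (G.bfsLayer v j)).IsDisjointUnionOfPaths :=
  ⟨fun _ _ _ hG => isFractionallyFragile_treedepth hG.1 hG.2,
    fun _ _ _ hK₄ hK₂₃ v j => isDisjointUnionOfPaths_induce_bfsLayer hK₄ hK₂₃ v j⟩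

theorem mainTheorem8 :
    SimpleGraph.IsFractionallyFragileClass.{u}
      (fun _ G => G.IsOuterplanar)
      (fun _ G => (G.treedepth : ℝ))
      (fun a => 2 * (a : ℝ) * (1 + (⌈Real.logb 2 (a : ℝ)⌉ : ℝ))) ∧
    ∀ (V : Type u) [Finite V] (G : SimpleGraph V), G.IsOuterplanar → G.IsChordal →
      ∀ (v : V) (j : ℕ), (G.induce (G.bfsLayer v j)).IsDisjointUnionOfPaths :=
  ⟨fun V _ G hG => mainTheorem8_general.1 V G
      ⟨not_isMinor_top_four hG, not_isMinor_completeBipartite_two_three hG⟩,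
    fun V _ G hG _ => mainTheorem8_general.2 V G (not_isMinor_top_four hG)
      (not_isMinor_completeBipartite_two_three hG)⟩
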